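/- Consider the following random access machine. A program uses finitely many registers, one memory with cells addressed by $0,1,2,\dots$, and an output device that holds a set of numbers, initially empty. Registers and cells hold natural numbers. The following instructions take one time step each: loading a constant into a register, copying, adding and (truncated) subtracting registers, reading and writing the memory cell whose address is in a register, inserting a number into the set on the output device or deleting it if it is present, and outputting the set currently on the output device. Each test of an if or while statement (is a given register nonzero?), each entry into a sequential composition and each empty instruction also takes one step. There is no recursion. The input is a graph $G$ with vertex set $\{0,\dots,n-1\}$, given in memory by $n$ and the adjacency lists of the vertices, with the neighbours in arbitrary order and a table of the positions of the lists. **Theorem.** There is a single program with the following property. For every $\Delta$ there are a constant $C$ and a polynomial $p$, depending only on $\Delta$, such that for every $n\ge 0$ and every $n$-vertex graph $G$ of maximum degree at most $\Delta$, in any adjacency list representation, the program halts and outputs every maximal independent set of $G$ exactly once and nothing else. Moreover, with $N$ the number of maximal independent sets of $G$: 1. (constant amortized time per set) the first set is output after at most $C(n+1)$ steps, and the program halts at most $C N$ steps after that; if $G$ has no isolated vertex, the total number of steps, including this initialization, is at most $C N$; 2. (linear space) at every time, only memory cells with addresses less than $C(n+1)$ are nonzero, and all registers and cells hold numbers at most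 $C(n+1)$, so that the machine uses $O(n)$ words of $O(\log n)$ bits; 3. (polynomial delay) the number of steps before the first output, between any two consecutive outputs, and from the last output to halting is at most $p(n)$. -/

import Mathlib

namespace MISListing

/-- Programs of a random access machine with finitely many registers per program, one memory
`ℕ → ℕ` and an output device that holds a set of numbers. The only arithmetic is addition and
truncated subtraction; control flow is by sequencing, branching and loops, without recursion. -/
inductive Prog : Type
  /-- `reg r := k` -/
  | const (r k : ℕ)
  /-- `reg r := reg a` -/
  | copy (r a : ℕ)
  /-- `reg r := reg a + reg b` -/
  | add (r a b : ℕ)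
  /-- `reg r := reg a - reg b`, which is `0` if `reg a < reg b` -/
  | sub (r a b : ℕ)
  /-- `reg r := mem (reg a)` -/
  | load (r a : ℕ)
  /-- `mem (reg a) := reg b` -/
  | store (a b : ℕ)
  /-- insert the number `reg a` into the set on the output device, or delete it if present -/
  | toggle (a : ℕ)
  /-- output the set that is currently on the output device -/
  | output
  /-- do nothing -/
  | skip
  /-- run `p`, then `q` -/
  | seq (p q : Prog)
  /-- run `p` if `reg a ≠ 0`, otherwise `q` -/
  | ite (a : ℕ) (p q : Prog)
  /-- while `reg a ≠ 0`, run `p` -/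
  | loop (a : ℕ) (p : Prog)

/-- A configuration of the machine. The fields `cur`, `clock` and `log` cannot be read by the
program; the last two only record what happened. -/
structure Config where
  /-- The pieces of the program that remain to be run, in order (the program counter). They are
  subprograms of the program, at most one more than the nesting depth of the program in number. -/
  todo : List Prog
  /-- the registers -/
  reg : ℕ → ℕ
  /-- the memory -/
  mem : ℕ → ℕ
  /-- the set on the output device -/
  cur : Finset ℕ
  /-- the number of steps made -/
  clock : ℕ
  /-- the sets output so far in chronological order, each with the time of its output -/
  log : List (ℕ × Finset ℕ)

/-- One step of the machine; a machine with nothing left to run has halted. -/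
def step (c : Config) : Config :=
  match c.todo with
  | [] => c
  | p :: k =>
    let d : Config := { c with todo := k, clock := c.clock + 1 }
    match p with
    | .const r v => { d with reg := Function.update c.reg r v }
    | .copy r a => { d with reg := Function.update c.reg r (c.reg a) }
    | .add r a b => { d with reg := Function.update c.reg r (c.reg a + c.reg b) }
    | .sub r a b => { d with reg := Function.update c.reg r (c.reg a - c.reg b) }
    | .load r a => { d with reg := Function.update c.reg r (c.mem (c.reg a)) }
    | .store a b => { d with mem := Function.update c.mem (c.reg a) (c.reg b) }
    | .toggle a => { d with cur := symmDiff c.cur {c.reg a} }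
    | .output => { d with log := c.log ++ [(c.clock + 1, c.cur)] }
    | .skip => d
    | .seq p q => { d with todo := p :: q :: k }
    | .ite a p q => { d with todo := (if c.reg a ≠ 0 then p else q) :: k }
    | .loop a p => { d with todo := if c.reg a ≠ 0 then p :: .loop a p :: k else k }

/-- The start of program `P` on input `x`: the input is in memory from address `0` on, everything
else is zero, and the output device holds the empty set. -/
def start (P : Prog) (x : List ℕ) : Config where
  todo := [P]
  reg := fun _ => 0
  mem := fun a => x.getD a 0
  cur := ∅
  clock := 0
  log := []

/-- The configuration of program `P` on input `x` after `t` steps. -/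
def run (P : Prog) (x : List ℕ) (t : ℕ) : Config :=
  step^[t] (start P x)

/-- The configuration uses only the first `M` memory cells, and registers and memory
hold only numbers up to `M`. -/
def Config.Fits (c : Config) (M : ℕ) : Prop :=
  (∀ a, c.reg a ≤ M) ∧ (∀ a, c.mem a ≤ M) ∧ (∀ a, M ≤ a → c.mem a = 0)

/-- `adj` is an adjacency list representation of `G`, with the neighbours in any order. -/
def IsAdjList {n : ℕ} (G : SimpleGraph (Fin n)) (adj : Fin n → List (Fin n)) : Prop :=
  ∀ v, (adj v).Nodup ∧ ∀ w, w ∈ adj v ↔ G.Adj v w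

/-- Adjacency lists as machine input: the number `n` at address `0`, then at addresses
`1, …, n + 1` the addresses at which the lists of the vertices `0, …, n - 1` begin and the last
one ends, then from address `n + 2` on the concatenated lists. The neighbours of `v` are thus
found at the addresses from `mem (v + 1)` up to `mem (v + 2) - 1`. -/
def encode {n : ℕ} (adj : Fin n → List (Fin n)) : List ℕ :=
  n :: ((List.range (n + 1)).map fun i =>
      n + 2 + (((List.finRange n).take i).flatMap adj).length) ++
    ((List.finRange n).flatMap adj).map Fin.val

/-- A maximal independent set: independent, and contained in no larger independent set. -/
def IsMaxIndep {n : ℕ} (G : SimpleGraph (Fin n)) (I : Finset (Fin n)) : Prop :=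
  Maximal (fun J : Finset (Fin n) => G.IsIndepSet (J : Set (Fin n))) I

end MISListing

open MISListing

/-! The algorithm is a reverse search along a chain of induced subgraphs. Fix vertex sets V_r ⊂ … ⊂
V_n, where V_n contains all vertices, V_{j+1} is V_j plus one vertex o_j, and V_r spans no edge. The
nodes of level j are the maximal independent subsets of V_j, so V_r is the only root. With v = o_j,
the parent of a node J of level j+1 is J itself if v ∉ J, and otherwise J∖{v} completed greedily by
neighbours of v; it is maximal in V_j (`parent_mis`). Conversely a node I always has one child, I ∪
{v} or I, and the only other candidate is (I∖N(v)) ∪ {v} (`mem_kids_iff`). Hence every node has one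
or two children, all leaves lie on level n, and each maximal independent set of the graph is exactly
one leaf (`leaves_nodes`).

Every move in this tree only inspects a neighbourhood of v of bounded radius (for maximality of the
second child see `mis_childB_iff`), so it takes time depending on Δ alone. A child containing v is
the last one of its parent, and a child avoiding v is the first, so depth first search needs no
stack and the memory stays linear.

The running time is governed by the number of nodes, the sum over j of `num nb (V j)`. The chain is
built from the top: while the current set U contains both ends of an edge uw, N(u) ∪ N(w) is
removed. This deletes at most 2Δ vertices and at least halves the number of maximal independent sets
(`two_mul_num_le`). The levels therefore form a geometric series, and there are at most (4Δ+1)N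
nodes (`sum_num_le`). Since every node has a leaf below it on level n, consecutive outputs are O(n)
moves apart (`visit`). Without isolated vertices, every vertex of V_r has a removed neighbour and
the number of removed vertices is at most 4ΔN, so n = O(N) and the linear initialization is absorbed
(`le_mul_num`).

The link to the machine is a calculus of weakest preconditions, `wp`, refined to `Does`, which
tracks time, represented data and preserved registers. -/

namespace MISListing

/-! ### Weakest preconditions for the machine -/

/-- `c` leads to `c'` within the space bound `M`, the clock counting the steps. -/
def Reach (M : ℕ) (c c' : Config) : Prop :=
  ∃ t, step^[t] c = c' ∧ c'.clock = c.clock + t ∧ ∀ s ≤ t, (step^[s] c).Fits M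

theorem Reach.trans {M : ℕ} {c c' c'' : Config} (h : Reach M c c') (h' : Reach M c' c'') :
    Reach M c c'' := by
  obtain ⟨t, rfl, ht, hf⟩ := h
  obtain ⟨t', rfl, ht', hf'⟩ := h'
  refine ⟨t' + t, Function.iterate_add_apply _ _ _ _, by omega, fun s hs => ?_⟩
  rcases le_total s t with h | h
  · exact hf s h
  · obtain ⟨d, rfl⟩ := Nat.exists_eq_add_of_le h
    rw [Nat.add_comm, Function.iterate_add_apply]
    exact hf' d (by omega)

theorem Reach.one {M : ℕ} {c : Config} (h : c.Fits M) (h' : (step c).Fits M)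
    (ht : (step c).clock = c.clock + 1) : Reach M c (step c) := by
  refine ⟨1, rfl, ht, fun s hs => ?_⟩
  obtain rfl | rfl : s = 0 ∨ s = 1 := by omega
  · exact h
  · exact h'

/-- Started in `c`, program `p` terminates within space `M` in a configuration with `Q`. -/
def wp (M : ℕ) (p : Prog) (Q : Config → Prop) (c : Config) : Prop :=
  -- The remaining program `k` is arbitrary, which is what makes specifications of subprograms
  -- compose.
  c.Fits M → ∀ k, ∃ c', Reach M { c with todo := p :: k } { c' with todo := k } ∧
    c'.Fits M ∧ Q c'

theorem wp.mono {M : ℕ} {p : Prog} {Q Q' : Config → Prop} {c : Config} (h : wp M p Q c)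
    (hQ : ∀ c', Q c' → Q' c') : wp M p Q' c := fun hf k =>
  let ⟨c', h1, h2, h3⟩ := h hf k
  ⟨c', h1, h2, hQ _ h3⟩

theorem wp.seq {M : ℕ} {p q : Prog} {Q : Config → Prop} {c : Config}
    (h : wp M p (wp M q Q) { c with clock := c.clock + 1 }) : wp M (.seq p q) Q c := by
  intro hf k
  obtain ⟨c1, h1, h2, h3⟩ := h hf (q :: k)
  obtain ⟨c2, h4, h5, h6⟩ := h3 h2 k
  exact ⟨c2, ((Reach.one (c := { c with todo := .seq p q :: k }) hf hf rfl).trans h1).trans h4,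
    h5, h6⟩

theorem wp.ite {M a : ℕ} {p q : Prog} {Q : Config → Prop} {c : Config}
    (h : c.reg a ≠ 0 → wp M p Q { c with clock := c.clock + 1 })
    (h' : c.reg a = 0 → wp M q Q { c with clock := c.clock + 1 }) :
    wp M (.ite a p q) Q c := by
  intro hf k
  have h0 := Reach.one (M := M) (c := { c with todo := .ite a p q :: k }) hf hf rfl
  by_cases ha : c.reg a = 0
  · obtain ⟨c2, h4, h5, h6⟩ := h' ha hf k
    refine ⟨c2, h0.trans ?_, h5, h6⟩
    simpa [step, ha] using h4
  · obtain ⟨c2, h4, h5, h6⟩ := h ha hf k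
    refine ⟨c2, h0.trans ?_, h5, h6⟩
    simpa [step, ha] using h4

theorem wp.output {M : ℕ} {Q : Config → Prop} {c : Config}
    (h : Q { c with clock := c.clock + 1, log := c.log ++ [(c.clock + 1, c.cur)] }) :
    wp M .output Q c := fun hf _ =>
  ⟨{ c with clock := c.clock + 1, log := c.log ++ [(c.clock + 1, c.cur)] },
    Reach.one (c := { c with todo := .output :: _ }) hf hf rfl, hf, h⟩

theorem loop_exit {M a : ℕ} {p : Prog} {c : Config} (hf : c.Fits M) (ha : c.reg a = 0)
    (k : List Prog) :
    Reach M { c with todo := .loop a p :: k } { c with todo := k, clock := c.clock + 1 } := by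
  have h0 := Reach.one (M := M) (c := { c with todo := .loop a p :: k }) hf hf rfl
  simpa [step, ha] using h0

theorem loop_iterate {M a : ℕ} {p : Prog} {Q : Config → Prop} {c : Config} (hf : c.Fits M)
    (ha : c.reg a ≠ 0) (h : wp M p Q { c with clock := c.clock + 1 }) (k : List Prog) :
    ∃ c', Reach M { c with todo := .loop a p :: k } { c' with todo := .loop a p :: k } ∧
      c'.Fits M ∧ Q c' := by
  have h0 := Reach.one (M := M) (c := { c with todo := .loop a p :: k }) hf hf rfl
  obtain ⟨c2, h4, h5, h6⟩ := h hf (.loop a p :: k)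
  refine ⟨c2, h0.trans ?_, h5, h6⟩
  simpa [step, ha] using h4

theorem wp.loop_zero {M a : ℕ} {p : Prog} {Q : Config → Prop} {c : Config} (ha : c.reg a = 0)
    (h : Q { c with clock := c.clock + 1 }) : wp M (.loop a p) Q c :=
  fun hf k => ⟨{ c with clock := c.clock + 1 }, loop_exit hf ha k, hf, h⟩

theorem wp.loop_succ {M a : ℕ} {p : Prog} {Q : Config → Prop} {c : Config} (ha : c.reg a ≠ 0)
    (h : wp M p (wp M (.loop a p) Q) { c with clock := c.clock + 1 }) :
    wp M (.loop a p) Q c := by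
  intro hf k
  obtain ⟨c1, h1, h2, h3⟩ := loop_iterate hf ha h k
  obtain ⟨c2, h4, h5, h6⟩ := h3 h2 k
  exact ⟨c2, h1.trans h4, h5, h6⟩

/-- The effect of the instructions other than `output`, up to the clock, with the conditions under
which they respect the bound `M` and change none of the registers from `10` up to `k - 1`. -/
inductive Eff (M k : ℕ) : Prog → Config → Config → Prop
  | const {c : Config} {r v : ℕ} (h : v ≤ M) (hr : r < 10 ∨ k ≤ r) :
      Eff M k (.const r v) c { c with reg := Function.update c.reg r v }
  | copy {c : Config} {r a : ℕ} (hr : r < 10 ∨ k ≤ r) :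
      Eff M k (.copy r a) c { c with reg := Function.update c.reg r (c.reg a) }
  | add {c : Config} {r a b : ℕ} (hr : r < 10 ∨ k ≤ r) (h : c.reg a + c.reg b ≤ M) :
      Eff M k (.add r a b) c { c with reg := Function.update c.reg r (c.reg a + c.reg b) }
  | sub {c : Config} {r a b : ℕ} (hr : r < 10 ∨ k ≤ r) :
      Eff M k (.sub r a b) c { c with reg := Function.update c.reg r (c.reg a - c.reg b) }
  | load {c : Config} {r a : ℕ} (hr : r < 10 ∨ k ≤ r) :
      Eff M k (.load r a) c { c with reg := Function.update c.reg r (c.mem (c.reg a)) }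
  | store {c : Config} {a b : ℕ} (h : c.reg a < M) :
      Eff M k (.store a b) c { c with mem := Function.update c.mem (c.reg a) (c.reg b) }
  | toggle {c : Config} {a : ℕ} :
      Eff M k (.toggle a) c { c with cur := symmDiff c.cur {c.reg a} }
  | skip {c : Config} : Eff M k .skip c c

theorem fits_update_reg {M : ℕ} {c : Config} (hf : c.Fits M) {r v : ℕ} (h : v ≤ M) :
    Config.Fits { c with reg := Function.update c.reg r v } M := by
  refine ⟨fun a => ?_, hf.2⟩
  by_cases ha : a = r
  · subst ha; simpa using h
  · simpa [ha] using hf.1 a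

theorem Eff.fits {M k : ℕ} {p : Prog} {c c' : Config} (h : Eff M k p c c') (hf : c.Fits M) :
    c'.Fits M := by
  cases h with
  | const h _ => exact fits_update_reg hf h
  | copy _ => exact fits_update_reg hf (hf.1 _)
  | add _ h => exact fits_update_reg hf h
  | sub _ => exact fits_update_reg hf ((Nat.sub_le _ _).trans (hf.1 _))
  | load _ => exact fits_update_reg hf (hf.2.1 _)
  | @store _ a b h =>
    refine ⟨hf.1, fun x => ?_, fun x hx => ?_⟩
    · by_cases hxa : x = c.reg a
      · subst hxa; simpa using hf.1 b
      · simpa [hxa] using hf.2.1 x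
    · have hxa : x ≠ c.reg a := by omega
      simpa [hxa] using hf.2.2 x hx
  | toggle => exact hf
  | skip => exact hf

theorem Eff.frame {M k : ℕ} {p : Prog} {c c' : Config} (h : Eff M k p c c') (r : ℕ) (h1 : 10 ≤ r)
    (h2 : r < k) : c'.reg r = c.reg r := by
  cases h <;> first | rfl | exact Function.update_of_ne (by omega) _ _

theorem Eff.wp {M k : ℕ} {p : Prog} {c c' : Config} (h : Eff M k p c c') (τ : ℕ)
    (lg : List (ℕ × Finset ℕ)) {Q : Config → Prop}
    (hQ : Q { c' with clock := τ + 1, log := lg }) :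
    wp M p Q { c with clock := τ, log := lg } := by
  intro hf k'
  have hf' := h.fits (c := c) hf
  refine ⟨{ c' with clock := τ + 1, log := lg }, ?_, hf', hQ⟩
  have h0 : step { c with todo := p :: k', clock := τ, log := lg } =
      { c' with todo := k', clock := τ + 1, log := lg } := by
    cases h <;> rfl
  have := Reach.one (M := M) (c := { c with todo := p :: k', clock := τ, log := lg }) hf
    (by rw [h0]; exact hf') (by rw [h0])
  rwa [h0] at this

/-! ### Representation of the data in memory -/

/-- `inp` holds adjacency lists `nb` on the vertices below `n` at the addresses below `b`, and
`M` leaves room for four arrays of length `n` after them. -/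
structure Input (n b Δ M : ℕ) (nb : ℕ → List ℕ) (inp : ℕ → ℕ) : Prop where
  size : inp 0 = n
  finish : inp (n + 1) = b
  start_le : n + 2 ≤ b
  room : b + n + n + n + n + 2 ≤ M
  seg : ∀ v < n, inp (v + 1) + (nb v).length = inp (v + 2)
  seg_le : ∀ v < n, inp (v + 2) ≤ b
  get : ∀ v < n, ∀ j (h : j < (nb v).length), inp (inp (v + 1) + j) = (nb v)[j]
  lt : ∀ {v w}, w ∈ nb v → w < n
  symm : ∀ v w, w ∈ nb v → v ∈ nb w
  irrefl : ∀ v, v ∉ nb v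
  nodup : ∀ v, (nb v).Nodup
  deg : ∀ v, (nb v).length ≤ Δ

/-- The data of the algorithm: the current vertex set `U`, the current set `S`, which is also on
the output device, a set `O`, the vertex order `o`, and the registers `6` to `9`. -/
structure Data where
  U : Finset ℕ
  S : Finset ℕ
  O : Finset ℕ
  o : ℕ → ℕ
  i : ℕ
  ok : ℕ
  d : ℕ
  dir : ℕ

/-- The memory contents representing `A`. -/
def layout (n b : ℕ) (inp : ℕ → ℕ) (A : Data) (a : ℕ) : ℕ :=
  if a < b then inp a
  -- The flags of `U` are inverted: zeroed memory then represents the full vertex set, so no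
  -- initialization is needed.
  else if a < b + n then (if a - b ∈ A.U then 0 else 1)
  else if a < b + n + n then (if a - (b + n) ∈ A.S then 1 else 0)
  else if a < b + n + n + n then (if a - (b + n + n) ∈ A.O then 1 else 0)
  else if a < b + n + n + n + n then A.o (a - (b + n + n + n))
  else 0

section layout
variable {n b : ℕ} {inp : ℕ → ℕ} {A : Data}

theorem layout_inp {a : ℕ} (h : a < b) : layout n b inp A a = inp a := by
  simp [layout, h]

theorem layout_U {x : ℕ} (h : x < n) : layout n b inp A (b + x) = if x ∈ A.U then 0 else 1 := by
  rw [layout, if_neg (by omega), if_pos (by omega), show b + x - b = x by omega]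

theorem layout_S {x : ℕ} (h : x < n) :
    layout n b inp A (b + n + x) = if x ∈ A.S then 1 else 0 := by
  rw [layout, if_neg (by omega), if_neg (by omega), if_pos (by omega),
    show b + n + x - (b + n) = x by omega]

theorem layout_O {x : ℕ} (h : x < n) :
    layout n b inp A (b + n + n + x) = if x ∈ A.O then 1 else 0 := by
  rw [layout, if_neg (by omega), if_neg (by omega), if_neg (by omega), if_pos (by omega),
    show b + n + n + x - (b + n + n) = x by omega]

theorem layout_o {x : ℕ} (h : x < n) :
    layout n b inp A (b + n + n + n + x) = A.o x := by
  rw [layout, if_neg (by omega), if_neg (by omega), if_neg (by omega), if_neg (by omega),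
    if_pos (by omega), show b + n + n + n + x - (b + n + n + n) = x by omega]

theorem update_layout_erase_U {x : ℕ} (h : x < n) :
    Function.update (layout n b inp A) (b + x) 1 =
      layout n b inp { A with U := A.U.erase x } := by
  funext a
  by_cases ha : a = b + x
  · subst ha; simp [layout_U h]
  · rw [Function.update_of_ne ha]
    unfold layout
    split_ifs <;> simp_all <;> omega

theorem update_layout_insert_U {x : ℕ} (h : x < n) :
    Function.update (layout n b inp A) (b + x) 0 =
      layout n b inp { A with U := insert x A.U } := by
  funext a
  by_cases ha : a = b + x
  · subst ha; simp [layout_U h]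
  · rw [Function.update_of_ne ha]
    unfold layout
    split_ifs <;> simp_all <;> omega

theorem update_layout_S {x : ℕ} (h : x < n) :
    Function.update (layout n b inp A) (b + n + x) (1 - if x ∈ A.S then 1 else 0) =
      layout n b inp { A with S := symmDiff A.S {x} } := by
  funext a
  by_cases ha : a = b + n + x
  · subst ha; simp [layout_S h, Finset.mem_symmDiff]; grind
  · rw [Function.update_of_ne ha]
    unfold layout
    split_ifs <;> simp_all [Finset.mem_symmDiff] <;> omega

theorem update_layout_O {x : ℕ} (h : x < n) :
    Function.update (layout n b inp A) (b + n + n + x) (if x ∈ A.S then 1 else 0) =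
      layout n b inp { A with O := if x ∈ A.S then insert x A.O else A.O.erase x } := by
  funext a
  by_cases ha : a = b + n + n + x
  · subst ha; simp [layout_O h]; grind
  · rw [Function.update_of_ne ha]
    unfold layout
    split_ifs <;> simp_all <;> omega

theorem update_layout_o {x v : ℕ} (h : x < n) :
    Function.update (layout n b inp A) (b + n + n + n + x) v =
      layout n b inp { A with o := Function.update A.o x v } := by
  funext a
  by_cases ha : a = b + n + n + n + x
  · subst ha; simp [layout_o h]
  · rw [Function.update_of_ne ha]
    unfold layout
    split_ifs
    any_goals rfl
    show _ = Function.update A.o x v _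
    rw [Function.update_of_ne (by omega)]

theorem layout_congr {A' : Data} (hU : A'.U = A.U) (hS : A'.S = A.S) (hO : A'.O = A.O)
    (ho : A'.o = A.o) : layout n b inp A' = layout n b inp A := by
  unfold layout; rw [hU, hS, hO, ho]

end layout

/-- Configuration `c` represents the data `A`. -/
structure Rep (n b : ℕ) (inp : ℕ → ℕ) (c : Config) (A : Data) : Prop where
  mem : c.mem = layout n b inp A
  cur : c.cur = A.S
  r0 : c.reg 0 = 1
  r1 : c.reg 1 = n
  r2 : c.reg 2 = b
  r3 : c.reg 3 = b + n
  r4 : c.reg 4 = b + n + n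
  r5 : c.reg 5 = b + n + n + n
  r6 : c.reg 6 = A.i
  r7 : c.reg 7 = A.ok
  r8 : c.reg 8 = A.d
  r9 : c.reg 9 = A.dir

/-! ### Specifications with time bounds, and loops -/

/-- Program `p`, run from `c`, takes at most `t` steps, outputs nothing, keeps the registers from
`10` up to `k - 1`, and ends with data having `Q`. -/
def Does (n b M : ℕ) (inp : ℕ → ℕ) (k t : ℕ) (p : Prog) (c : Config) (Q : Data → Prop) : Prop :=
  -- Neither the program nor `Rep` sees clock and log, so both may be arbitrary at the start.
  ∀ τ lg, wp M p (fun c' => (∃ A', Rep n b inp c' A' ∧ Q A') ∧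
    (∀ r, 10 ≤ r → r < k → c'.reg r = c.reg r) ∧ c'.log = lg ∧ c'.clock ≤ τ + t)
    { c with clock := τ, log := lg }

section Does
variable {n b M : ℕ} {inp : ℕ → ℕ} {k t t₁ t₂ a : ℕ} {p q : Prog} {c : Config}
  {Q Q₁ : Data → Prop}

/-- Registers from `10` on carry no data; all of them may serve as scratch space or loop variables.
-/
theorem Rep.of_agree {c c' : Config} {A : Data} (h : Rep n b inp c A) (hm : c'.mem = c.mem)
    (hc : c'.cur = c.cur) (hr : ∀ r < 10, c'.reg r = c.reg r) : Rep n b inp c' A := by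
  constructor <;> first | (rw [hm]; exact h.mem) | (rw [hc]; exact h.cur) | skip
  all_goals rw [hr _ (by norm_num)]
  exacts [h.r0, h.r1, h.r2, h.r3, h.r4, h.r5, h.r6, h.r7, h.r8, h.r9]

theorem Does.mono {k' t' : ℕ} {Q' : Data → Prop} (h : Does n b M inp k t p c Q) (hk : k' ≤ k)
    (ht : t ≤ t') (hQ : ∀ A, Q A → Q' A) : Does n b M inp k' t' p c Q' := fun τ lg =>
  (h τ lg).mono fun _ ⟨⟨A', hA, hq⟩, h2, h3, h4⟩ =>
    ⟨⟨A', hA, hQ _ hq⟩, fun r hr hr' => h2 r hr (by omega), h3, by omega⟩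

theorem Does.le {k' t' : ℕ} (h : Does n b M inp k t p c Q) (hk : k' ≤ k) (ht : t ≤ t') :
    Does n b M inp k' t' p c Q := h.mono hk ht fun _ h => h

theorem Does.seq (hp : Does n b M inp k t₁ p c Q₁)
    (hq : ∀ c' A', Rep n b inp c' A' → Q₁ A' → (∀ r, 10 ≤ r → r < k → c'.reg r = c.reg r) →
      Does n b M inp k t₂ q c' Q) : Does n b M inp k (t₁ + t₂ + 1) (.seq p q) c Q := by
  intro τ lg
  refine wp.seq ((hp (τ + 1) lg).mono ?_)
  rintro c' ⟨⟨A', hA, hq1⟩, h2, h3, h4⟩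
  refine (hq c' A' hA hq1 h2 c'.clock c'.log).mono ?_
  rintro c'' ⟨h5, h6, h7, h8⟩
  exact ⟨h5, fun r hr hr' => (h6 r hr hr').trans (h2 r hr hr'), h7.trans h3, by omega⟩

theorem Does.seq_le (t₂ : ℕ) (hp : Does n b M inp k t₁ p c Q₁) (ht : t₁ + t₂ + 1 ≤ t)
    (hq : ∀ c' A', Rep n b inp c' A' → Q₁ A' → (∀ r, 10 ≤ r → r < k → c'.reg r = c.reg r) →
      Does n b M inp k t₂ q c' Q) : Does n b M inp k t (.seq p q) c Q :=
  (hp.seq hq).le le_rfl ht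

theorem Does.ite (hp : c.reg a ≠ 0 → Does n b M inp k t p c Q)
    (hq : c.reg a = 0 → Does n b M inp k t q c Q) :
    Does n b M inp k (t + 1) (.ite a p q) c Q := by
  intro τ lg
  refine wp.ite (fun ha => ?_) (fun ha => ?_)
  · exact (hp ha (τ + 1) lg).mono fun _ ⟨h1, h2, h3, h4⟩ => ⟨h1, h2, h3, by omega⟩
  · exact (hq ha (τ + 1) lg).mono fun _ ⟨h1, h2, h3, h4⟩ => ⟨h1, h2, h3, by omega⟩

theorem Does.eff {c' : Config} {A' : Data} (h : Eff M k p c c') (hA : Rep n b inp c' A')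
    (hQ : Q A') : Does n b M inp k 1 p c Q := fun τ lg =>
  h.wp τ lg ⟨⟨A', hA.of_agree rfl rfl fun _ _ => rfl, hQ⟩, h.frame, rfl, le_rfl⟩

/-- The intermediate configuration need not represent any data. This matters when, for example,
memory has been changed but the output device has not yet followed. -/
theorem Does.eff_seq {c' : Config} (h : Eff M k p c c') (hq : Does n b M inp k t q c' Q) :
    Does n b M inp k (t + 2) (.seq p q) c Q := by
  intro τ lg
  refine wp.seq (h.wp (τ + 1) lg ((hq (τ + 1 + 1) lg).mono ?_))
  rintro c'' ⟨h5, h6, h7, h8⟩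
  exact ⟨h5, fun r hr hr' => (h6 r hr hr').trans (h.frame r hr hr'), h7, by omega⟩

end Does

infixr:65 " ;; " => Prog.seq

/-- `for reg k in [reg k, reg (k + 1)) do p` -/
def forRange (k : ℕ) (p : Prog) : Prog :=
  .sub (k + 2) (k + 1) k ;; .loop (k + 2) (p ;; .add k k 0 ;; .sub (k + 2) (k + 1) k)

/-- `for reg (k + 3) in neighbours of reg a do p` -/
def forNbrs (k a : ℕ) (p : Prog) : Prog :=
  .add (k + 1) a 0 ;; .load k (k + 1) ;; .add (k + 1) (k + 1) 0 ;; .load (k + 1) (k + 1) ;;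
    forRange k (.load (k + 3) k ;; p)

section loops
variable {n b M : ℕ} {inp : ℕ → ℕ} {k t : ℕ} {p : Prog} {c : Config}

/-- Induction on the number `m` of remaining rounds. The register `k + 2` holds the truncated
difference of end and counter and so serves as loop test; register `0` holds the increment 1. -/
theorem does_loop {Inv : ℕ → Data → Prop} {e : ℕ} (hk : 10 ≤ k) (he : e ≤ M)
    (hbody : ∀ c' A j, j < e → Rep n b inp c' A → Inv j A → c'.reg k = j →
      (∀ r, 10 ≤ r → r < k → c'.reg r = c.reg r) →
      Does n b M inp (k + 2) t p c' (Inv (j + 1)))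
    (m : ℕ) (c' : Config) (A : Data) (j : ℕ) (hj : j + m = e) (hA : Rep n b inp c' A)
    (hI : Inv j A) (h0 : c'.reg k = j) (h1 : c'.reg (k + 1) = e) (h2 : c'.reg (k + 2) = e - j)
    (hfr : ∀ r, 10 ≤ r → r < k → c'.reg r = c.reg r) :
    Does n b M inp k (m * (t + 6) + 1)
      (.loop (k + 2) (p ;; .add k k 0 ;; .sub (k + 2) (k + 1) k)) c' (Inv e) := by
  induction m generalizing c' A j with
  | zero =>
    intro τ lg
    refine wp.loop_zero (show c'.reg (k + 2) = 0 by omega) ?_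
    obtain rfl : j = e := by omega
    exact ⟨⟨A, hA.of_agree rfl rfl fun _ _ => rfl, hI⟩, fun _ _ _ => rfl, rfl,
      show τ + 1 ≤ _ by omega⟩
  | succ m ih =>
    intro τ lg
    refine wp.loop_succ (show c'.reg (k + 2) ≠ 0 by omega) (wp.seq ?_)
    refine (hbody c' A j (by omega) hA hI h0 hfr (τ + 1 + 1) lg).mono ?_
    rintro c1 ⟨⟨A1, hA1, hI1⟩, hf1, hl1, ht1⟩
    have e0 : c1.reg k = j := (hf1 k hk (by omega)).trans h0
    have e1 : c1.reg (k + 1) = e := (hf1 _ (by omega) (by omega)).trans h1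
    have e2 : c1.reg 0 = 1 := hA1.r0
    refine wp.seq (Eff.wp (k := k) (c := c1) (.add (by omega) (by omega)) _ _ ?_)
    refine Eff.wp (k := k) (c := { c1 with reg := _ }) (.sub (by omega)) _ _ ?_
    set f := Function.update c1.reg k (c1.reg k + c1.reg 0) with hf
    have := ih { c1 with reg := Function.update f (k + 2) (f (k + 1) - f k) } A1 (j + 1) (by omega)
      (hA1.of_agree rfl rfl fun r hr => by
        show Function.update _ _ _ r = _
        rw [Function.update_of_ne (by omega), Function.update_of_ne (by omega)]) hI1
      (by simp [hf, e0, e2]) (by simp [hf, e1]) (by simp [hf, e0, e1, e2])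
      (fun r hr hr' => by
        show Function.update _ _ _ r = _
        rw [Function.update_of_ne (by omega), Function.update_of_ne (by omega),
          hf1 r hr (by omega), hfr r hr hr']) (c1.clock + 1 + 1 + 1) lg
    rw [← hl1] at this
    refine this.mono ?_
    rintro c2 ⟨h3, h4, h5, h6⟩
    refine ⟨h3, fun r hr hr' => ?_, h5.trans hl1, ?_⟩
    · rw [h4 r hr hr']
      show Function.update _ _ _ r = _
      rw [Function.update_of_ne (by omega), Function.update_of_ne (by omega),
        hf1 r hr (by omega)]
    · have : (m + 1) * (t + 6) = m * (t + 6) + (t + 6) := by ring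
      omega

theorem does_forRange {Inv : ℕ → Data → Prop} {A : Data} {i e : ℕ} (hk : 10 ≤ k) (hie : i ≤ e)
    (he : e ≤ M) (h0 : c.reg k = i) (h1 : c.reg (k + 1) = e)
    (hA : Rep n b inp c A) (hI : Inv i A)
    (hbody : ∀ c' A j, i ≤ j → j < e → Rep n b inp c' A → Inv j A → c'.reg k = j →
      (∀ r, 10 ≤ r → r < k → c'.reg r = c.reg r) →
      Does n b M inp (k + 2) t p c' (Inv (j + 1))) :
    Does n b M inp k ((e - i) * (t + 6) + 3) (forRange k p) c (Inv e) := by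
  have := does_loop (n := n) (b := b) (M := M) (inp := inp) (k := k) (t := t) (p := p) (c := c)
    (Inv := fun j A => i ≤ j ∧ Inv j A) (e := e) hk he
    (fun c' A j hj hA hI h hfr => (hbody c' A j hI.1 hj hA hI.2 h hfr).mono le_rfl le_rfl
      fun _ h => ⟨by omega, h⟩) (e - i)
    { c with reg := Function.update c.reg (k + 2) (c.reg (k + 1) - c.reg k) } A i (by omega)
    (hA.of_agree rfl rfl fun r hr => Function.update_of_ne (by omega) _ _) ⟨le_rfl, hI⟩
    (by simp [h0]) (by simp [h1]) (by simp [h0, h1])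
    (fun r hr hr' => Function.update_of_ne (by omega) _ _)
  exact (Does.eff_seq (.sub (by omega)) this).mono le_rfl (by omega) fun _ h => h.2

/-- The invariant is indexed by the list of neighbours still to be treated. The body also learns
that this list is a suffix of `nb y`, so that the absence of duplicates can be used there. -/
theorem does_forNbrs {Δ : ℕ} {nb : ℕ → List ℕ} (hin : Input n b Δ M nb inp)
    {Inv : List ℕ → Data → Prop} {A : Data} {a y : ℕ}
    (hk : 10 ≤ k) (ha : c.reg a = y) (hy : y < n) (hA : Rep n b inp c A) (hI : Inv (nb y) A)
    (hbody : ∀ c' A x l, Rep n b inp c' A → (∃ l', nb y = l' ++ x :: l) → x < n →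
      Inv (x :: l) A → c'.reg (k + 3) = x → (∀ r, 10 ≤ r → r < k → c'.reg r = c.reg r) →
      Does n b M inp (k + 4) t p c' (Inv l)) :
    Does n b M inp k (Δ * (t + 8) + 11) (forNbrs k a p) c (Inv []) := by
  have hroom := hin.room
  have hle := hin.start_le
  have hseg := hin.seg y hy
  have hsegle := hin.seg_le y hy
  have hlen := hin.deg y
  refine Does.mono (k := k) (t := (inp (y + 2) - inp (y + 1)) * (t + 2 + 6) + 3 + 2 + 2 + 2 + 2) ?_
    le_rfl ?_ (Q := (fun j A => Inv ((nb y).drop (j - inp (y + 1))) A) (inp (y + 2))) ?_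
  · refine Does.eff_seq (.add (by omega) (by rw [ha, hA.r0]; omega)) ?_
    refine Does.eff_seq (.load (by omega)) ?_
    refine Does.eff_seq (.add (by omega) ?_) ?_
    · simp [Function.update_of_ne (show 0 ≠ k by omega), hA.r0, ha]; omega
    refine Does.eff_seq (.load (by omega)) ?_
    have ne0 : (0 : ℕ) ≠ k := by omega
    refine (does_forRange (A := A) (i := inp (y + 1)) (e := inp (y + 2))
      (Inv := fun j A => Inv ((nb y).drop (j - inp (y + 1))) A) hk (by omega) (by omega)
      ?_ ?_ ?_ (by simpa using hI) ?_)
    · simp [ha, hA.r0, hA.mem, layout_inp (show y + 1 < b by omega)]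
    · simp [ne0, ha, hA.r0, hA.mem, layout_inp (show y + 2 < b by omega)]
    · refine hA.of_agree rfl rfl fun r hr => ?_
      have : r ≠ k := by omega
      have : r ≠ k + 1 := by omega
      simp [*]
    · intro c' A' j hj hj' hA' hI' hr hfr
      refine Does.eff_seq (.load (by omega)) ?_
      have hj2 : j - inp (y + 1) < (nb y).length := by omega
      have hx : c'.mem (c'.reg k) = (nb y)[j - inp (y + 1)] := by
        rw [hr, hA'.mem, layout_inp (by omega), ← hin.get y hy _ hj2]
        congr 1; omega
      rw [List.drop_eq_getElem_cons hj2] at hI'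
      refine (hbody { c' with reg := Function.update c'.reg (k + 3) (c'.mem (c'.reg k)) }
        A' _ _ (hA'.of_agree rfl rfl fun r hr => ?_) ⟨(nb y).take (j - inp (y + 1)), ?_⟩
        (hin.lt (List.getElem_mem hj2)) hI' ?_ ?_).mono (Nat.le_add_right _ 2) le_rfl fun A'' h => ?_
      · exact Function.update_of_ne (by omega) _ _
      · rw [← List.drop_eq_getElem_cons hj2, List.take_append_drop]
      · simp [hx]
      · intro r hr1 hr2
        refine (Function.update_of_ne (by omega) _ _).trans ((hfr r hr1 hr2).trans ?_)
        have : r ≠ k := by omega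
        have : r ≠ k + 1 := by omega
        simp [*]
      · convert h using 2; omega
  · have h : inp (y + 2) - inp (y + 1) ≤ Δ := by omega
    have := Nat.mul_le_mul_right (t + 8) h
    have : t + 2 + 6 = t + 8 := rfl
    rw [this]; omega
  · intro A h
    have h' : Inv ((nb y).drop (inp (y + 2) - inp (y + 1))) A := h
    rwa [List.drop_eq_nil_of_le (by omega)] at h'

end loops

/-! ### Reverse search: parents and children -/

section enumeration
variable {nb : ℕ → List ℕ} {U S I J : Finset ℕ} {u v w : ℕ}

/-- `S` is a maximal independent subset of `U`, in the graph with adjacency lists `nb`. -/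
def MIS (nb : ℕ → List ℕ) (U S : Finset ℕ) : Prop :=
  S ⊆ U ∧ ∀ u ∈ U, u ∈ S ↔ ∀ w ∈ nb u, w ∉ S

/-- Greedily add to `S` the vertices of the list that are in `U`. -/
def complete (nb : ℕ → List ℕ) (U S : Finset ℕ) (l : List ℕ) : Finset ℕ :=
  l.foldl (fun S u => if u ∈ U ∧ u ∉ S ∧ ∀ w ∈ nb u, w ∉ S then insert u S else S) S

theorem complete_cons (l : List ℕ) : complete nb U S (u :: l) =
    complete nb U (if u ∈ U ∧ u ∉ S ∧ ∀ w ∈ nb u, w ∉ S then insert u S else S) l := rfl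

theorem subset_complete (l : List ℕ) : S ⊆ complete nb U S l := by
  induction l generalizing S with
  | nil => exact subset_rfl
  | cons u l ih =>
    rw [complete_cons]
    refine Finset.Subset.trans ?_ ih
    split_ifs
    exacts [Finset.subset_insert _ _, subset_rfl]

theorem mem_of_mem_complete (l : List ℕ) (h : u ∈ complete nb U S l) :
    u ∈ S ∨ u ∈ U ∧ u ∈ l := by
  induction l generalizing S with
  | nil => exact .inl h
  | cons x l ih =>
    rw [complete_cons] at h
    have := ih h
    grind

theorem complete_indep (symm : ∀ v w, w ∈ nb v → v ∈ nb w) (irrefl : ∀ v, v ∉ nb v)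
    (l : List ℕ) (hS : ∀ u ∈ S, ∀ w ∈ nb u, w ∉ S) :
    ∀ u ∈ complete nb U S l, ∀ w ∈ nb u, w ∉ complete nb U S l := by
  induction l generalizing S with
  | nil => exact hS
  | cons x l ih =>
    rw [complete_cons]
    apply ih
    split_ifs with h
    · intro u hu w hw hw'
      rw [Finset.mem_insert] at hu hw'
      rcases hu with rfl | hu <;> rcases hw' with rfl | hw'
      · exact irrefl _ hw
      · exact h.2.2 _ hw hw'
      · exact h.2.2 _ (symm _ _ hw) hu
      · exact hS u hu w hw hw'
    · exact hS

/-- If `u` is rejected at its turn, it is already in the set or has a neighbour there, and the set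
only grows afterwards. -/
theorem complete_dominates (l : List ℕ) (hu : u ∈ l) (hU : u ∈ U)
    (h : ∀ w ∈ nb u, w ∉ complete nb U S l) : u ∈ complete nb U S l := by
  induction l generalizing S with
  | nil => simp at hu
  | cons x l ih =>
    rw [complete_cons] at h ⊢
    rcases List.mem_cons.1 hu with rfl | hu
    · by_cases hx : u ∈ U ∧ u ∉ S ∧ ∀ w ∈ nb u, w ∉ S
      · rw [if_pos hx]
        exact subset_complete l (Finset.mem_insert_self _ _)
      · rw [if_neg hx] at h ⊢
        by_contra hu'
        exact hx ⟨hU, fun hS => hu' (subset_complete l hS),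
          fun w hw hS => h w hw (subset_complete l hS)⟩
    · exact ih hu h

theorem complete_eq_self (l : List ℕ) (h : MIS nb U I) : complete nb U I l = I := by
  induction l with
  | nil => rfl
  | cons x l ih =>
    rw [complete_cons, if_neg, ih]
    rintro ⟨h1, h2, h3⟩
    exact h2 ((h.2 _ h1).2 h3)

theorem MIS.indep (h : MIS nb U I) : ∀ u ∈ I, ∀ w ∈ nb u, w ∉ I :=
  fun u hu => (h.2 u (h.1 hu)).1 hu

theorem exists_mis (symm : ∀ v w, w ∈ nb v → v ∈ nb w) (irrefl : ∀ v, v ∉ nb v)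
    (hS : S ⊆ U) (hi : ∀ u ∈ S, ∀ w ∈ nb u, w ∉ S) : ∃ J, S ⊆ J ∧ MIS nb U J := by
  refine ⟨complete nb U S U.toList, subset_complete _, fun u hu => ?_, fun u hu => ?_⟩
  · rcases mem_of_mem_complete _ hu with h | h
    exacts [hS h, h.1]
  · exact ⟨complete_indep symm irrefl _ hi u,
      complete_dominates _ (Finset.mem_toList.2 hu) hu⟩

/-- The parent of `J`, which is maximal in `insert v U`. -/
def parent (nb : ℕ → List ℕ) (U : Finset ℕ) (v : ℕ) (J : Finset ℕ) : Finset ℕ :=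
  if v ∈ J then complete nb U (J.erase v) (nb v) else J

/-- The child that exists always. -/
def childA (nb : ℕ → List ℕ) (v : ℕ) (I : Finset ℕ) : Finset ℕ :=
  if ∀ w ∈ nb v, w ∉ I then insert v I else I

/-- The candidate for a second child. -/
def childB (nb : ℕ → List ℕ) (v : ℕ) (I : Finset ℕ) : Finset ℕ :=
  insert v (I.filter (· ∉ nb v))

/-- `I` has the second child `childB nb v I`. -/
def HasB (nb : ℕ → List ℕ) (U : Finset ℕ) (v : ℕ) (I : Finset ℕ) : Prop :=
  -- Without a neighbour of `v` in `I` the candidate would coincide with `childA nb v I`. The last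
  -- condition says, for `v ∉ I`, that the parent of the candidate is `I`.
  (∃ w ∈ nb v, w ∈ I) ∧ MIS nb (insert v U) (childB nb v I) ∧
    complete nb U (I.filter (· ∉ nb v)) (nb v) = I

open Classical in
/-- The children of `I`. -/
noncomputable def kids (nb : ℕ → List ℕ) (U : Finset ℕ) (v : ℕ) (I : Finset ℕ) :
    List (Finset ℕ) :=
  childA nb v I :: if HasB nb U v I then [childB nb v I] else []

theorem mem_kids : J ∈ kids nb U v I ↔ J = childA nb v I ∨ HasB nb U v I ∧ J = childB nb v I := by
  unfold kids; split_ifs with h <;> simp [h]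

/-- When the second child exists, the first one is `I` and avoids `v`, while the second contains
`v`. -/
theorem kids_nodup (hv : v ∉ U) (hI : I ⊆ U) : (kids nb U v I).Nodup := by
  unfold kids
  split_ifs with h
  · have : childA nb v I = I := by
      obtain ⟨w, hw, hw'⟩ := h.1
      exact if_neg fun h => h w hw hw'
    rw [List.nodup_cons, this]
    refine ⟨fun h' => hv (hI ?_), List.nodup_singleton _⟩
    rw [List.mem_singleton] at h'
    rw [h']
    exact Finset.mem_insert_self _ _
  · exact List.nodup_singleton _

/-- Deleting `v` from `J` can leave only neighbours of `v` undominated, and exactly these are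
offered to the greedy completion. -/
theorem parent_mis (symm : ∀ v w, w ∈ nb v → v ∈ nb w) (irrefl : ∀ v, v ∉ nb v) (hv : v ∉ U)
    (hJ : MIS nb (insert v U) J) : MIS nb U (parent nb U v J) := by
  unfold parent
  split_ifs with h
  · refine ⟨fun u hu => ?_, fun u hu => ⟨complete_indep symm irrefl _ ?_ u, fun h' => ?_⟩⟩
    · rcases mem_of_mem_complete _ hu with h | h
      · have := hJ.1 (Finset.mem_of_mem_erase h)
        exact Finset.mem_of_mem_insert_of_ne this (Finset.ne_of_mem_erase h)
      · exact h.1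
    · intro u hu w hw hw'
      exact hJ.indep u (Finset.mem_of_mem_erase hu) w hw (Finset.mem_of_mem_erase hw')
    · by_cases huv : u ∈ nb v
      · exact complete_dominates _ huv hu h'
      · refine subset_complete _ (Finset.mem_erase.2 ⟨fun h => hv (h ▸ hu), ?_⟩)
        rw [hJ.2 u (Finset.mem_insert_of_mem hu)]
        intro w hw hwJ
        refine h' w hw (subset_complete _ (Finset.mem_erase.2 ⟨?_, hwJ⟩))
        rintro rfl
        exact huv (symm _ _ hw)
  · refine ⟨fun u hu => ?_, fun u hu => hJ.2 u (Finset.mem_insert_of_mem hu)⟩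
    exact Finset.mem_of_mem_insert_of_ne (hJ.1 hu) fun h' => h (h' ▸ hu)

theorem childA_mis (symm : ∀ v w, w ∈ nb v → v ∈ nb w) (irrefl : ∀ v, v ∉ nb v) (hv : v ∉ U)
    (hI : MIS nb U I) : MIS nb (insert v U) (childA nb v I) := by
  have hvI : v ∉ I := fun h => hv (hI.1 h)
  unfold childA
  split_ifs with h
  · refine ⟨Finset.insert_subset_insert _ hI.1, fun u hu => ?_⟩
    rcases Finset.mem_insert.1 hu with rfl | hu'
    · refine iff_of_true (Finset.mem_insert_self _ _) fun w hw hw' => ?_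
      rcases Finset.mem_insert.1 hw' with rfl | hw'
      exacts [irrefl _ hw, h w hw hw']
    · have huv : u ≠ v := fun h => hv (h ▸ hu')
      rw [Finset.mem_insert, or_iff_right huv, hI.2 u hu']
      constructor
      · intro h1 w hw hw'
        rcases Finset.mem_insert.1 hw' with rfl | hw'
        · exact h u (symm _ _ hw) ((hI.2 u hu').2 h1)
        · exact h1 w hw hw'
      · exact fun h1 w hw hw' => h1 w hw (Finset.mem_insert_of_mem hw')
  · refine ⟨hI.1.trans (Finset.subset_insert _ _), fun u hu => ?_⟩
    rcases Finset.mem_insert.1 hu with rfl | hu'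
    · exact iff_of_false hvI h
    · exact hI.2 u hu'

theorem parent_childA (hv : v ∉ U) (hI : MIS nb U I) : parent nb U v (childA nb v I) = I := by
  have hvI : v ∉ I := fun h => hv (hI.1 h)
  unfold childA
  split_ifs with h
  · rw [parent, if_pos (Finset.mem_insert_self _ _), Finset.erase_insert hvI,
      complete_eq_self _ hI]
  · rw [parent, if_neg hvI]

theorem parent_childB (hvI : v ∉ I) (h : complete nb U (I.filter (· ∉ nb v)) (nb v) = I) :
    parent nb U v (childB nb v I) = I := by
  rw [parent, childB, if_pos (Finset.mem_insert_self _ _), Finset.erase_insert, h]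
  simp [hvI]

/-- If `v ∈ J`, then `J` contains no neighbour of `v` and the completion adds only such neighbours.
So `J.erase v` is the parent without the neighbours of `v`, and `J` is recovered as `childB` of its
parent. If `v ∉ J`, the parent is `J`, and maximality gives a neighbour of `v` in it, so `childA`
returns `J`. -/
theorem mem_kids_iff (symm : ∀ v w, w ∈ nb v → v ∈ nb w) (irrefl : ∀ v, v ∉ nb v) (hv : v ∉ U) :
    MIS nb U I ∧ J ∈ kids nb U v I ↔ MIS nb (insert v U) J ∧ parent nb U v J = I := by
  constructor
  · rintro ⟨hI, hJ⟩
    have hvI : v ∉ I := fun h => hv (hI.1 h)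
    rcases mem_kids.1 hJ with rfl | ⟨hB, rfl⟩
    · exact ⟨childA_mis symm irrefl hv hI, parent_childA hv hI⟩
    · exact ⟨hB.2.1, parent_childB hvI hB.2.2⟩
  · rintro ⟨hJ, rfl⟩
    have hI := parent_mis symm irrefl hv hJ
    refine ⟨hI, mem_kids.2 ?_⟩
    have hvI : v ∉ parent nb U v J := fun h => hv (hI.1 h)
    by_cases hvJ : v ∈ J
    · have hpar : parent nb U v J = complete nb U (J.erase v) (nb v) := if_pos hvJ
      have hX : (parent nb U v J).filter (· ∉ nb v) = J.erase v := by
        ext u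
        rw [Finset.mem_filter, hpar]
        constructor
        · rintro ⟨h1, h2⟩
          rcases mem_of_mem_complete _ h1 with h | h
          exacts [h, absurd h.2 h2]
        · intro h
          exact ⟨subset_complete _ h, fun h' => hJ.indep v hvJ u h' (Finset.mem_of_mem_erase h)⟩
      have hB : childB nb v (parent nb U v J) = J := by
        rw [childB, hX, Finset.insert_erase hvJ]
      by_cases h : ∀ w ∈ nb v, w ∉ parent nb U v J
      · left
        rw [childA, if_pos h]
        conv_lhs => rw [← hB]
        rw [childB, Finset.filter_true_of_mem]
        exact fun w hw hw' => h w hw' hw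
      · right
        push Not at h
        exact ⟨⟨h, hB.symm ▸ hJ, by rw [hX, hpar]⟩, hB.symm⟩
    · left
      have hpar : parent nb U v J = J := if_neg hvJ
      rw [hpar, childA, if_neg]
      exact fun h => hvJ ((hJ.2 v (Finset.mem_insert_self _ _)).2 h)

/-- Independence is automatic. A vertex `w` can lose its dominating vertices only if one of them is
a removed neighbour `u` of `v`; then `w` is a neighbour of `u`. So maximality need only be tested
within distance two of `v`. -/
theorem mis_childB_iff (symm : ∀ v w, w ∈ nb v → v ∈ nb w) (irrefl : ∀ v, v ∉ nb v) (hv : v ∉ U)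
    (hI : MIS nb U I) : MIS nb (insert v U) (childB nb v I) ↔
      ∀ u ∈ nb v, ∀ w ∈ nb u, w ∈ U → w ∉ childB nb v I → ∃ x ∈ nb w, x ∈ childB nb v I := by
  constructor
  · intro h u _ w _ hwU hw
    by_contra! h'
    exact hw ((h.2 w (Finset.mem_insert_of_mem hwU)).2 h')
  · intro h
    have hmem : ∀ x, x ∈ childB nb v I ↔ x = v ∨ x ∈ I ∧ x ∉ nb v := by simp [childB]
    refine ⟨fun x hx => ?_, fun w hw => ⟨fun hwB x hx hxB => ?_, fun hwB => ?_⟩⟩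
    · rcases (hmem x).1 hx with rfl | hx
      exacts [Finset.mem_insert_self _ _, Finset.mem_insert_of_mem (hI.1 hx.1)]
    · rcases (hmem w).1 hwB with rfl | hw <;> rcases (hmem x).1 hxB with rfl | hx'
      · exact irrefl _ hx
      · exact hx'.2 hx
      · exact hw.2 (symm _ _ hx)
      · exact hI.indep _ hw.1 _ hx hx'.1
    · rcases Finset.mem_insert.1 hw with rfl | hwU
      · exact (hmem _).2 (.inl rfl)
      by_contra hw'
      have hwv : w ∉ nb v := fun h' => hwB v (symm _ _ h') ((hmem v).2 (.inl rfl))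
      have hwI : w ∉ I := fun h' => hw' ((hmem w).2 (.inr ⟨h', hwv⟩))
      rw [hI.2 w hwU] at hwI
      push Not at hwI
      obtain ⟨x, hx, hxI⟩ := hwI
      by_cases hxv : x ∈ nb v
      · obtain ⟨y, hy, hyB⟩ := h x hxv w (symm _ _ hx) hwU hw'
        exact hwB y hy hyB
      · exact hwB x hx ((hmem x).2 (.inr ⟨hxI, hxv⟩))

/-! ### Counting maximal independent sets -/

open Classical in
/-- The number of maximal independent subsets of `U`. -/
noncomputable def num (nb : ℕ → List ℕ) (U : Finset ℕ) : ℕ :=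
  (U.powerset.filter (MIS nb U)).card

theorem num_eq_length {L : List (Finset ℕ)} (hL : L.Nodup) (h : ∀ S, S ∈ L ↔ MIS nb U S) :
    num nb U = L.length := by
  classical
  rw [num, ← List.toFinset_card_of_nodup hL]
  congr 1
  ext S
  rw [Finset.mem_filter, List.mem_toFinset, h, Finset.mem_powerset]
  exact ⟨fun h => h.2, fun h => ⟨h.1, h⟩⟩

theorem num_pos (symm : ∀ v w, w ∈ nb v → v ∈ nb w) (irrefl : ∀ v, v ∉ nb v) :
    0 < num nb U := by
  classical
  obtain ⟨J, -, hJ⟩ := exists_mis (S := ∅) symm irrefl (Finset.empty_subset U) (by simp)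
  exact Finset.card_pos.2 ⟨J, Finset.mem_filter.2 ⟨Finset.mem_powerset.2 hJ.1, hJ⟩⟩

/-- A vertex of `J ∩ U` has no neighbour in `I ⊆ J`, so maximality of `I` forces it into `I`. Thus
`I` can be read off from any maximal extension. -/
theorem MIS.inter_eq {U' : Finset ℕ} (hI : MIS nb U I) (hJ : MIS nb U' J) (h : I ⊆ J) :
    J ∩ U = I := by
  ext x
  rw [Finset.mem_inter]
  refine ⟨fun ⟨hx, hxU⟩ => ?_, fun hx => ⟨h hx, hI.1 hx⟩⟩
  rw [hI.2 x hxU]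
  exact fun w hw hwI => hJ.indep x hx w hw (h hwI)

/-- Each maximal independent subset of `U` extends to one of `U'`, from which intersection with `U`
recovers it. -/
theorem num_mono (symm : ∀ v w, w ∈ nb v → v ∈ nb w) (irrefl : ∀ v, v ∉ nb v)
    {U' : Finset ℕ} (h : U ⊆ U') : num nb U ≤ num nb U' := by
  classical
  refine Finset.card_le_card_of_surjOn (· ∩ U) fun I hI => ?_
  have hI' := (Finset.mem_filter.1 (Finset.mem_coe.1 hI)).2
  obtain ⟨J, hIJ, hJ⟩ := exists_mis symm irrefl (hI'.1.trans h) hI'.indep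
  exact ⟨J, Finset.mem_coe.2 (Finset.mem_filter.2 ⟨Finset.mem_powerset.2 hJ.1, hJ⟩),
    hI'.inter_eq hJ hIJ⟩

/-- Deleting the neighbourhoods of two adjacent vertices halves the number of maximal independent
sets. -/
theorem two_mul_num_le (symm : ∀ v w, w ∈ nb v → v ∈ nb w) (irrefl : ∀ v, v ∉ nb v)
    (hu : u ∈ U) (hw : w ∈ U) (huw : w ∈ nb u) {U' : Finset ℕ}
    (hU' : ∀ x, x ∈ U' ↔ x ∈ U ∧ x ∉ nb u ∧ x ∉ nb w) : 2 * num nb U' ≤ num nb U := by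
  classical
  -- For either end `v` of the edge, `I ∪ {v}` is independent and extends to a maximal set that
  -- contains `v` and meets `U'` in `I`.
  have key : ∀ v ∈ U, (∀ x ∈ U', x ∉ nb v) →
      num nb U' ≤ ((U.powerset.filter (MIS nb U)).filter (v ∈ ·)).card := by
    intro v hv hvU
    refine Finset.card_le_card_of_surjOn (· ∩ U') fun I hI => ?_
    have hI' := (Finset.mem_filter.1 (Finset.mem_coe.1 hI)).2
    obtain ⟨J, hIJ, hJ⟩ := exists_mis (S := insert v I) (U := U) symm irrefl
      (Finset.insert_subset hv fun x hx => ((hU' x).1 (hI'.1 hx)).1) (by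
        intro x hx y hy hy'
        rcases Finset.mem_insert.1 hx with rfl | hx' <;>
          rcases Finset.mem_insert.1 hy' with rfl | hy''
        · exact irrefl _ hy
        · exact hvU _ (hI'.1 hy'') hy
        · exact hvU _ (hI'.1 hx') (symm _ _ hy)
        · exact hI'.indep x hx' y hy hy'')
    rw [Finset.insert_subset_iff] at hIJ
    exact ⟨J, Finset.mem_coe.2 (Finset.mem_filter.2 ⟨Finset.mem_filter.2
      ⟨Finset.mem_powerset.2 hJ.1, hJ⟩, hIJ.1⟩), hI'.inter_eq hJ hIJ.2⟩
  have h1 := key u hu fun x hx => ((hU' x).1 hx).2.1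
  have h2 := key w hw fun x hx => ((hU' x).1 hx).2.2
  -- No independent set contains both ends of the edge, so the two families do not overlap and each
  -- accounts for `num nb U'`.
  have hd : Disjoint ((U.powerset.filter (MIS nb U)).filter (u ∈ ·))
      ((U.powerset.filter (MIS nb U)).filter (w ∈ ·)) := by
    rw [Finset.disjoint_left]
    intro J h1 h2
    rw [Finset.mem_filter, Finset.mem_filter] at h1 h2
    exact h1.1.2.indep u h1.2 w huw h2.2
  have h3 := Finset.card_le_card (Finset.union_subset
    (Finset.filter_subset (u ∈ ·) (U.powerset.filter (MIS nb U)))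
    (Finset.filter_subset (w ∈ ·) (U.powerset.filter (MIS nb U))))
  rw [Finset.card_union_of_disjoint hd] at h3
  have : num nb U = (U.powerset.filter (MIS nb U)).card := rfl
  omega

/-! ### The search tree and its size -/

/-- The sets at depth `m` below node `I` of level `j`, in the order of depth first search. -/
noncomputable def leaves (nb : ℕ → List ℕ) (V : ℕ → Finset ℕ) (o : ℕ → ℕ) :
    ℕ → ℕ → Finset ℕ → List (Finset ℕ)
  | 0, _, I => [I]
  | m + 1, j, I => (kids nb (V j) (o j) I).flatMap (leaves nb V o m (j + 1))

/-- The number of nodes to depth `m` below node `I` of level `j`. -/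
noncomputable def nodes (nb : ℕ → List ℕ) (V : ℕ → Finset ℕ) (o : ℕ → ℕ) :
    ℕ → ℕ → Finset ℕ → ℕ
  | 0, _, _ => 1
  | m + 1, j, I => 1 + ((kids nb (V j) (o j) I).map (nodes nb V o m (j + 1))).sum

/-- The induction treats a whole level at once: `L` lists level `j`, and the children of its members
list level `j + 1`, completely because each set has a parent and without repetition because it has
only one. -/
theorem leaves_nodes (symm : ∀ v w, w ∈ nb v → v ∈ nb w) (irrefl : ∀ v, v ∉ nb v)
    {V : ℕ → Finset ℕ} {o : ℕ → ℕ} (m : ℕ) : ∀ (j : ℕ) (L : List (Finset ℕ)),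
    (∀ i, j ≤ i → i < j + m → o i ∉ V i ∧ V (i + 1) = insert (o i) (V i)) →
    L.Nodup → (∀ S, S ∈ L ↔ MIS nb (V j) S) →
    (L.flatMap (leaves nb V o m j)).Nodup ∧
    (∀ S, S ∈ L.flatMap (leaves nb V o m j) ↔ MIS nb (V (j + m)) S) ∧
    (L.map (nodes nb V o m j)).sum = ∑ i ∈ Finset.Ico j (j + m + 1), num nb (V i) := by
  induction m with
  | zero =>
    intro j L _ hL hmem
    have : L.flatMap (leaves nb V o 0 j) = L := by simp [leaves]
    rw [this]
    refine ⟨hL, hmem, ?_⟩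
    simp [nodes, num_eq_length hL hmem]
  | succ m ih =>
    intro j L hV hL hmem
    obtain ⟨hv, hVj⟩ := hV j le_rfl (by omega)
    have hfm : L.flatMap (leaves nb V o (m + 1) j) =
        (L.flatMap (kids nb (V j) (o j))).flatMap (leaves nb V o m (j + 1)) := by
      rw [List.flatMap_assoc]; rfl
    have hkid : ∀ S, S ∈ L.flatMap (kids nb (V j) (o j)) ↔ MIS nb (V (j + 1)) S := by
      intro S
      rw [List.mem_flatMap, hVj]
      constructor
      · rintro ⟨I, hI, hS⟩
        exact ((mem_kids_iff symm irrefl hv).1 ⟨(hmem I).1 hI, hS⟩).1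
      · intro hS
        have := (mem_kids_iff symm irrefl hv).2 ⟨hS, rfl⟩
        exact ⟨_, (hmem _).2 this.1, this.2⟩
    have hnd : (L.flatMap (kids nb (V j) (o j))).Nodup := by
      rw [List.nodup_flatMap]
      refine ⟨fun I hI => kids_nodup hv ((hmem I).1 hI).1, hL.imp_of_mem fun {I I'} hI hI' hne => ?_⟩
      intro S h1 h2
      exact hne (((mem_kids_iff symm irrefl hv).1 ⟨(hmem I).1 hI, h1⟩).2.symm.trans
        ((mem_kids_iff symm irrefl hv).1 ⟨(hmem I').1 hI', h2⟩).2)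
    obtain ⟨h1, h2, h3⟩ := ih (j + 1) _ (fun i h h' => hV i (by omega) (by omega)) hnd hkid
    rw [hfm]
    refine ⟨h1, by rwa [show j + (m + 1) = j + 1 + m by omega], ?_⟩
    rw [Finset.sum_eq_sum_Ico_succ_bot (by omega), show j + (m + 1) + 1 = j + 1 + m + 1 by omega,
      ← h3, num_eq_length hL hmem]
    clear hfm hkid hnd h1 h2 h3 hmem hL hV
    induction L with
    | nil => simp
    | cons I L ih =>
      simp only [List.map_cons, List.sum_cons, List.length_cons, List.flatMap_cons,
        List.map_append, List.sum_append, nodes] at ih ⊢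
      omega

end enumeration

/-! ### Local subprograms and their correctness -/

/-- flip the membership of `reg a` in the current set -/
def flip (a : ℕ) : Prog :=
  .add 50 3 a ;; .load 51 50 ;; .sub 51 0 51 ;; .store 50 51 ;; .toggle a

/-- `reg 8 := 1` if `reg a` or one of its neighbours is in the current set, otherwise `0` -/
def dominated (a : ℕ) : Prog :=
  .add 40 3 a ;; .load 8 40 ;;
    forNbrs 40 a (.add 44 3 43 ;; .load 44 44 ;; .ite 44 (.const 8 1) .skip)

/-- `reg 8 := 0` if `reg a` is in `U` and not dominated, otherwise `1` -/
def blocked (a : ℕ) : Prog :=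
  .add 40 2 a ;; .load 8 40 ;; .ite 8 .skip (dominated a)

/-- remove the neighbours of `reg a` from the current set, saving what was there -/
def clear (a : ℕ) : Prog :=
  forNbrs 20 a (.add 24 3 23 ;; .load 24 24 ;; .add 25 4 23 ;; .store 25 24 ;;
    .ite 24 (flip 23) .skip)

/-- `reg 7 := 0` if a vertex of `U` at distance at most two from `reg a` is not dominated -/
def checkMaximal (a : ℕ) : Prog :=
  forNbrs 20 a (forNbrs 30 23 (blocked 33 ;; .ite 8 .skip (.const 7 0)))

/-- greedily add neighbours of `reg a` to the current set -/
def completeNbrs (a : ℕ) : Prog :=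
  forNbrs 20 a (blocked 23 ;; .ite 8 .skip (flip 23))

/-- restore what was saved, with `reg 7 := 0` if this makes a difference -/
def restore (a : ℕ) : Prog :=
  forNbrs 20 a (.add 24 3 23 ;; .load 24 24 ;; .add 25 4 23 ;; .load 25 25 ;; .sub 26 24 25 ;;
    -- The sum of the two truncated differences is 1 exactly if the current and the saved flag
    -- differ.
    .sub 25 25 24 ;; .add 24 25 26 ;; .ite 24 (.const 7 0 ;; flip 23) .skip)

section subprograms
variable {n b Δ M : ℕ} {nb : ℕ → List ℕ} {inp : ℕ → ℕ} {c : Config} {A : Data} {a x : ℕ}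

theorem Rep.change {c' : Config} {A' : Data} (h : Rep n b inp c A)
    (hm : c'.mem = layout n b inp A') (hc : c'.cur = A'.S) (hr : ∀ r < 10, c'.reg r = c.reg r)
    (h6 : A'.i = A.i) (h7 : A'.ok = A.ok) (h8 : A'.d = A.d) (h9 : A'.dir = A.dir) :
    Rep n b inp c' A' := by
  constructor <;> first | exact hm | exact hc | skip
  all_goals rw [hr _ (by norm_num)]
  exacts [h.r0, h.r1, h.r2, h.r3, h.r4, h.r5, h.r6.trans h6.symm, h.r7.trans h7.symm,
    h.r8.trans h8.symm, h.r9.trans h9.symm]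

theorem Rep.change_ok {c' : Config} {v : ℕ} (h : Rep n b inp c A)
    (hm : c'.mem = c.mem) (hc : c'.cur = c.cur) (hr : ∀ r < 10, r ≠ 7 → c'.reg r = c.reg r)
    (h7 : c'.reg 7 = v) : Rep n b inp c' { A with ok := v } := by
  constructor <;> first | exact hm.trans h.mem | exact hc.trans h.cur | exact h7 | skip
  all_goals rw [hr _ (by norm_num) (by norm_num)]
  exacts [h.r0, h.r1, h.r2, h.r3, h.r4, h.r5, h.r6, h.r8, h.r9]

theorem Rep.change_d {c' : Config} {v : ℕ} (h : Rep n b inp c A)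
    (hm : c'.mem = c.mem) (hc : c'.cur = c.cur) (hr : ∀ r < 10, r ≠ 8 → c'.reg r = c.reg r)
    (h8 : c'.reg 8 = v) : Rep n b inp c' { A with d := v } := by
  constructor <;> first | exact hm.trans h.mem | exact hc.trans h.cur | exact h8 | skip
  all_goals rw [hr _ (by norm_num) (by norm_num)]
  exacts [h.r0, h.r1, h.r2, h.r3, h.r4, h.r5, h.r6, h.r7, h.r9]

theorem update_of_lt {f : ℕ → ℕ} {i v r k : ℕ} (hr : r < k) (hi : k ≤ i) :
    Function.update f i v r = f r := Function.update_of_ne (by omega) _ _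

theorem does_flip (hin : Input n b Δ M nb inp) (hA : Rep n b inp c A) (ha : c.reg a = x)
    (hx : x < n) (ha' : a < 50) :
    Does n b M inp 50 9 (flip a) c (· = { A with S := symmDiff A.S {x} }) := by
  have hroom := hin.room
  have h1 : a ≠ 50 := by omega
  have h2 : a ≠ 51 := by omega
  refine Does.eff_seq (.add (by omega) (by rw [ha, hA.r3]; omega)) ?_
  refine Does.eff_seq (.load (by omega)) ?_
  refine Does.eff_seq (.sub (by omega)) ?_
  refine Does.eff_seq (.store ?_) ?_
  · simp [ha, hA.r3]; omega
  refine Does.eff (A' := { A with S := symmDiff A.S {x} }) .toggle (hA.change ?_ ?_ (fun r hr => ?_) rfl rfl rfl rfl) rfl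
  · simp [ha, hA.r3, hA.r0, hA.mem, layout_S hx, ← update_layout_S hx]
  · simp [h1, h2, ha, hA.cur]
  · simp [update_of_lt (f := _) hr]

theorem does_dominated (hin : Input n b Δ M nb inp) (hA : Rep n b inp c A) (ha : c.reg a = x)
    (hx : x < n) (ha' : a < 40) (ha2 : 10 ≤ a) :
    Does n b M inp 40 (Δ * 14 + 15) (dominated a) c
      (· = { A with d := if x ∈ A.S ∨ ∃ y ∈ nb x, y ∈ A.S then 1 else 0 }) := by
  have hroom := hin.room
  have h1 : a ≠ 40 := by omega
  have h2 : a ≠ 8 := by omega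
  refine Does.eff_seq (.add (by omega) (by rw [ha, hA.r3]; omega)) ?_
  refine Does.eff_seq (.load (by omega)) ?_
  refine (does_forNbrs (t := 6) (A := { A with d := if x ∈ A.S then 1 else 0 }) hin
    -- Found so far or still to be found among the remaining neighbours: this disjunction does not
    -- change during the loop.
    (Inv := fun l A' => A' = { A with d := A'.d } ∧ A'.d ≤ 1 ∧
      ((A'.d = 1 ∨ ∃ y ∈ l, y ∈ A.S) ↔ (x ∈ A.S ∨ ∃ y ∈ nb x, y ∈ A.S)))
    (by omega) (y := x) ?_ hx ?_ ?_ ?_).mono le_rfl le_rfl ?_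
  · simp [h1, h2, ha]
  · refine hA.change_d rfl rfl (fun r hr hr' => ?_) ?_
    · simp [hr', update_of_lt hr]
    · simp [ha, hA.r3, hA.mem, layout_S hx]
  · refine ⟨rfl, ?_, ?_⟩ <;> dsimp only <;> split_ifs <;> simp [*]
  · rintro c' A' y l hA' - hy ⟨h1, h2, h3⟩ hr -
    replace hr : c'.reg 43 = y := hr
    refine Does.eff_seq (.add (by omega) (by rw [hr, hA'.r3]; omega)) ?_
    refine Does.eff_seq (.load (by omega)) ?_
    have hS : A'.S = A.S := by rw [h1]
    refine Does.ite (fun h => ?_) (fun h => ?_)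
    · refine Does.eff (.const (by omega) (by omega)) (hA'.change_d (v := 1) rfl rfl
        (fun r hr hr' => ?_) ?_) ⟨?_, le_rfl, ?_⟩
      · simp [hr', update_of_lt hr]
      · simp
      · rw [h1]
      · simp only [true_or, true_iff]
        have : y ∈ A.S := by
          by_contra hyS
          exact h (by simp [hr, hA'.r3, hA'.mem, layout_S hy, hS, hyS])
        exact h3.1 (.inr ⟨y, by simp, this⟩)
    · refine Does.eff .skip (hA'.of_agree rfl rfl fun r hr => ?_) ⟨h1, h2, ?_⟩
      · simp [update_of_lt hr]
      · have : y ∉ A.S := by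
          intro hyS
          simp [hr, hA'.r3, hA'.mem, layout_S hy, hS, hyS] at h
        rw [← h3]
        simp [this]
  · rintro A' ⟨h1, h2, h3⟩
    rw [h1]
    congr 1
    simp only [List.not_mem_nil, false_and, exists_false, or_false] at h3
    split_ifs with h <;> rw [← h3] at h <;> omega

theorem does_blocked (hin : Input n b Δ M nb inp) (hA : Rep n b inp c A) (ha : c.reg a = x)
    (hx : x < n) (ha' : a < 40) (ha2 : 10 ≤ a) :
    Does n b M inp 40 (Δ * 14 + 20) (blocked a) c
      (· = { A with d := if x ∈ A.U ∧ x ∉ A.S ∧ ∀ y ∈ nb x, y ∉ A.S then 0 else 1 }) := by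
  have hroom := hin.room
  have h1 : a ≠ 40 := by omega
  have h2 : a ≠ 8 := by omega
  refine Does.eff_seq (.add (by omega) (by rw [ha, hA.r2]; omega)) ?_
  refine Does.eff_seq (t := Δ * 14 + 15 + 1) (.load (by omega)) ?_
  set f := Function.update c.reg 40 (c.reg 2 + c.reg a) with hf
  have hR : Rep n b inp { c with reg := Function.update f 8 (c.mem (f 40)) }
      { A with d := if x ∈ A.U then 0 else 1 } := by
    refine hA.change_d rfl rfl (fun r hr hr' => ?_) ?_
    · simp [hf, hr', update_of_lt hr]
    · simp [hf, ha, hA.r2, hA.mem, layout_U hx]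
  refine Does.ite (fun h => ?_) (fun h => ?_)
  · refine (Does.eff .skip hR ?_).mono le_rfl (by omega) (fun _ h => h)
    have : x ∉ A.U := fun h' => h (by simp [hf, ha, hA.r2, hA.mem, layout_U hx, h'])
    simp [this]
  · have : x ∈ A.U := by
      by_contra h'
      simp [hf, ha, hA.r2, hA.mem, layout_U hx, h'] at h
    refine (does_dominated hin hR (x := x) ?_ hx ha' ha2).mono le_rfl le_rfl ?_
    · simp [hf, h1, h2, ha]
    · rintro _ rfl
      simp only [Data.mk.injEq, true_and, and_true, this]
      split_ifs <;> grind

end subprograms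
section subprograms
variable {n b Δ M : ℕ} {nb : ℕ → List ℕ} {inp : ℕ → ℕ} {c : Config} {A : Data} {a x : ℕ}

/-- Outside `nb x` the saved set `O` keeps arbitrary contents, which spares any cleaning; only the
flags of neighbours are read later. -/
theorem does_clear (hin : Input n b Δ M nb inp) (hA : Rep n b inp c A) (ha : c.reg a = x)
    (hx : x < n) :
    Does n b M inp 20 (Δ * 26 + 11) (clear a) c fun A' =>
      A' = { A with S := A.S.filter (· ∉ nb x), O := A'.O } ∧
        ∀ y ∈ nb x, y ∈ A'.O ↔ y ∈ A.S := by
  have hroom := hin.room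
  refine (does_forNbrs (t := 18) (A := A) hin
    (Inv := fun l A' => A' = { A with S := A'.S, O := A'.O } ∧
      (∀ y, y ∈ A'.S ↔ y ∈ A.S ∧ (y ∈ nb x → y ∈ l)) ∧
      ∀ y ∈ nb x, y ∈ l ∨ (y ∈ A'.O ↔ y ∈ A.S))
    (by omega) ha hx hA ⟨rfl, by simp, fun y hy => .inl hy⟩ ?_).mono le_rfl le_rfl ?_
  · rintro c' A' y l hA' ⟨l', hl⟩ hy ⟨h1, h2, h3⟩ hr -
    replace hr : c'.reg 23 = y := hr
    have hnd := hin.nodup x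
    rw [hl, List.nodup_append, List.nodup_cons] at hnd
    have hyx : y ∈ nb x := by rw [hl]; simp
    refine Does.eff_seq (.add (by omega) (by rw [hr, hA'.r3]; omega)) ?_
    refine Does.eff_seq (.load (by omega)) ?_
    refine Does.eff_seq (.add (by omega) ?_) ?_
    · simp [hr, hA'.r4]; omega
    refine Does.eff_seq (.store ?_) ?_
    · simp [hr, hA'.r4]; omega
    set B : Data := { A' with O := if y ∈ A'.S then insert y A'.O else A'.O.erase y } with hB
    have hR : ∀ c'' : Config,
        c''.mem = Function.update c'.mem (b + n + n + y) (if y ∈ A'.S then 1 else 0) →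
        c''.cur = c'.cur → (∀ r < 10, c''.reg r = c'.reg r) → Rep n b inp c'' B := by
      intro c'' hm hc hr
      refine hA'.change ?_ (hc.trans hA'.cur) hr rfl rfl rfl rfl
      rw [hm, hA'.mem, update_layout_O hy]
    have hO : ∀ z ∈ nb x, z ∈ l ∨ (z ∈ B.O ↔ z ∈ A.S) := by
      intro z hz
      have hyS := h2 y
      by_cases hzy : z = y
      · right
        subst hzy
        simp only [List.mem_cons, true_or, implies_true, and_true] at hyS
        simp only [hB]
        split_ifs with h <;> simp [← hyS, h]
      · rcases h3 z hz with h | h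
        · exact .inl ((List.mem_cons.1 h).resolve_left hzy)
        · right
          rw [← h]
          simp only [hB]
          split_ifs <;> simp [hzy]
    refine Does.ite (fun h => ?_) (fun h => ?_)
    · have hyS : y ∈ A'.S := by
        by_contra h'
        simp [hr, hA'.r3, hA'.r4, hA'.mem, layout_S hy, h'] at h
      refine Does.mono (does_flip (a := 23) hin (hR _ ?_ rfl fun r hr => ?_) (x := y) ?_ hy
        (by omega)) (by omega) le_rfl ?_
      · simp [hr, hA'.r4, hA'.r3, hA'.mem, layout_S hy]
      · simp [update_of_lt hr]
      · simp [hr]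
      · rintro _ rfl
        refine ⟨?_, fun z => ?_, hO⟩
        · simp only [hB]; rw [h1]
        · have : z ∈ symmDiff A'.S {y} ↔ z ∈ A'.S ∧ z ≠ y := by
            rw [Finset.mem_symmDiff, Finset.mem_singleton]
            constructor
            · rintro (h | ⟨rfl, h⟩)
              exacts [h, absurd hyS h]
            · exact .inl
          simp only [hB, this, h2, List.mem_cons]
          constructor
          · rintro ⟨⟨h1, h2⟩, h3⟩
            exact ⟨h1, fun h => (h2 h).resolve_left h3⟩
          · rintro ⟨h1, h2'⟩
            refine ⟨⟨h1, fun h => .inr (h2' h)⟩, ?_⟩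
            rintro rfl
            exact hnd.2.1.1 (h2' hyx)
    · have hyS : y ∉ A'.S := by
        intro h'
        simp [hr, hA'.r3, hA'.r4, hA'.mem, layout_S hy, h'] at h
      refine Does.le (Does.eff .skip (hR _ ?_ rfl fun r hr => ?_) ⟨?_, fun z => ?_, hO⟩) le_rfl
        (by omega)
      · simp [hr, hA'.r4, hA'.r3, hA'.mem, layout_S hy]
      · simp [update_of_lt hr]
      · simp only [hB]; rw [h1]
      · simp only [hB, h2, List.mem_cons]
        have := (h2 y).not.1 hyS
        simp only [List.mem_cons, true_or, implies_true, and_true] at this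
        constructor
        · rintro ⟨h1, h2⟩
          refine ⟨h1, fun h => (h2 h).resolve_left ?_⟩
          rintro rfl
          exact this h1
        · rintro ⟨h1, h2⟩
          exact ⟨h1, fun h => .inr (h2 h)⟩
  · rintro A' ⟨h1, h2, h3⟩
    refine ⟨?_, fun y hy => (h3 y hy).resolve_left (by simp)⟩
    have : A'.S = A.S.filter (· ∉ nb x) := by
      ext y
      rw [h2, Finset.mem_filter]
      simp
    rw [← this]
    exact h1

theorem does_checkMaximal (hin : Input n b Δ M nb inp) (hA : Rep n b inp c A) (ha : c.reg a = x)
    (hx : x < n) :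
    Does n b M inp 20 (Δ * (Δ * (Δ * 14 + 31) + 19) + 11) (checkMaximal a) c fun A' =>
      A' = { A with ok := A'.ok, d := A'.d } ∧ (A'.ok ≠ 0 ↔ A.ok ≠ 0 ∧
        ∀ u ∈ nb x, ∀ w ∈ nb u, w ∈ A.U → w ∉ A.S → ∃ y ∈ nb w, y ∈ A.S) := by
  set P : ℕ → Prop := fun w => w ∈ A.U → w ∉ A.S → ∃ y ∈ nb w, y ∈ A.S with hP
  refine (does_forNbrs (t := Δ * (Δ * 14 + 31) + 11) (A := A) hin
    (Inv := fun l A' => A' = { A with ok := A'.ok, d := A'.d } ∧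
      ((A'.ok ≠ 0 ∧ ∀ u ∈ l, ∀ w ∈ nb u, P w) ↔ A.ok ≠ 0 ∧ ∀ u ∈ nb x, ∀ w ∈ nb u, P w))
    (by omega) ha hx hA ⟨rfl, Iff.rfl⟩ ?_).mono le_rfl le_rfl ?_
  · rintro c' A' u l hA' - hu ⟨h1, h2⟩ hr -
    refine (does_forNbrs (t := Δ * 14 + 23) (A := A') hin (Inv := fun l' A'' =>
      A'' = { A with ok := A''.ok, d := A''.d } ∧
      ((A''.ok ≠ 0 ∧ (∀ w ∈ l', P w) ∧ ∀ u ∈ l, ∀ w ∈ nb u, P w) ↔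
        A.ok ≠ 0 ∧ ∀ u ∈ nb x, ∀ w ∈ nb u, P w))
      (by omega) (y := u) hr hu hA' ⟨h1, ?_⟩ ?_).mono (by omega) le_rfl ?_
    · rw [← h2]; simp
    · rintro c'' A'' w l' hA'' - hw ⟨h3, h4⟩ hr' -
      refine Does.seq (t₂ := 2) ((does_blocked (a := 33) hin hA'' (x := w) hr' hw (by omega) (by omega)).mono
        (by omega) le_rfl fun _ h => h) ?_
      rintro c3 _ hA3 rfl -
      have hPw : (w ∈ A''.U ∧ w ∉ A''.S ∧ ∀ y ∈ nb w, y ∉ A''.S) ↔ ¬ P w := by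
        rw [h3, hP]; push Not; rfl
      have h8 := hA3.r8
      simp only [hPw] at h8
      refine Does.ite (fun h => ?_) (fun h => ?_)
      · rw [h8] at h
        have hw' : P w := by
          by_contra h'
          simp [h'] at h
        refine Does.eff .skip hA3 ⟨?_, ?_⟩
        · dsimp only; rw [h3]
        · rw [← h4]; simp [hw']
      · rw [h8] at h
        have hw' : ¬ P w := by
          intro h'
          simp [h'] at h
        refine Does.eff (.const (by omega) (by omega)) (hA3.change_ok (v := 0) rfl rfl
          (fun r _ hr => Function.update_of_ne hr _ _) (by simp)) ⟨?_, ?_⟩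
        · dsimp only; rw [h3]
        · rw [← h4]; simp [hw']
    · rintro A'' ⟨h3, h4⟩
      exact ⟨h3, by rw [← h4]; simp⟩
  · rintro A' ⟨h1, h2⟩
    exact ⟨h1, by rw [← h2]; simp⟩

theorem does_completeNbrs (hin : Input n b Δ M nb inp) (hA : Rep n b inp c A) (ha : c.reg a = x)
    (hx : x < n) :
    Does n b M inp 20 (Δ * (Δ * 14 + 39) + 11) (completeNbrs a) c fun A' =>
      A' = { A with S := complete nb A.U A.S (nb x), d := A'.d } := by
  refine (does_forNbrs (t := Δ * 14 + 31) (A := A) hin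
    -- Completing the current set along the remaining list always yields the same final result.
    (Inv := fun l A' => A' = { A with S := A'.S, d := A'.d } ∧
      complete nb A.U A'.S l = complete nb A.U A.S (nb x))
    (by omega) ha hx hA ⟨rfl, rfl⟩ ?_).mono le_rfl le_rfl ?_
  · rintro c' A' u l hA' - hu ⟨h1, h2⟩ hr -
    refine Does.seq (t₂ := 10) ((does_blocked (a := 23) hin hA' (x := u) hr hu (by omega) (by omega)).mono
      (by omega) le_rfl fun _ h => h) ?_
    rintro c1 _ hA1 rfl hf1
    have h8 := hA1.r8
    rw [complete_cons] at h2
    have hU : A'.U = A.U := by rw [h1]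
    refine Does.ite (fun h => ?_) (fun h => ?_)
    · rw [h8, hU] at h
      refine (Does.eff .skip hA1 ⟨?_, ?_⟩).mono le_rfl (by omega) fun _ h => h
      · dsimp only; rw [h1]
      · dsimp only
        rwa [if_neg] at h2
        intro h'
        exact h (if_pos h')
    · rw [h8, hU] at h
      have h' : u ∈ A.U ∧ u ∉ A'.S ∧ ∀ w ∈ nb u, w ∉ A'.S := by
        by_contra h'
        simp [if_neg h'] at h
      refine (does_flip (a := 23) hin hA1 (x := u) ((hf1 23 (by omega) (by omega)).trans hr) hu
        (by omega)).mono (by omega) le_rfl ?_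
      rintro _ rfl
      refine ⟨?_, ?_⟩
      · dsimp only; rw [h1]
      · dsimp only
        rw [if_pos h'] at h2
        rw [← h2]
        congr 1
        ext z
        rw [Finset.mem_symmDiff, Finset.mem_singleton, Finset.mem_insert]
        constructor
        · rintro (h | h)
          exacts [.inr h.1, .inl h.1]
        · rintro (rfl | h)
          · exact .inr ⟨rfl, h'.2.1⟩
          · exact .inl ⟨h, fun hz => h'.2.1 (hz ▸ h)⟩
  · rintro A' ⟨h1, h2⟩
    have : A'.S = complete nb A.U A.S (nb x) := h2
    rw [← this]
    exact h1

theorem does_restore (hin : Input n b Δ M nb inp) (hA : Rep n b inp c A) (ha : c.reg a = x)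
    (hx : x < n) :
    Does n b M inp 20 (Δ * 34 + 11) (restore a) c fun A' =>
      A' = { A with S := A'.S, ok := A'.ok } ∧
        (∀ y, y ∈ A'.S ↔ if y ∈ nb x then y ∈ A.O else y ∈ A.S) ∧
        (A'.ok ≠ 0 ↔ A.ok ≠ 0 ∧ ∀ y ∈ nb x, y ∈ A.O ↔ y ∈ A.S) := by
  have hroom := hin.room
  refine (does_forNbrs (t := 26) (A := A) hin
    (Inv := fun l A' => A' = { A with S := A'.S, ok := A'.ok } ∧
      (∀ y, y ∈ A'.S ↔ if y ∈ nb x ∧ y ∉ l then y ∈ A.O else y ∈ A.S) ∧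
      ((A'.ok ≠ 0 ∧ ∀ y ∈ l, y ∈ A.O ↔ y ∈ A.S) ↔
        A.ok ≠ 0 ∧ ∀ y ∈ nb x, y ∈ A.O ↔ y ∈ A.S))
    (by omega) ha hx hA ⟨rfl, ?_, Iff.rfl⟩ ?_).mono le_rfl le_rfl ?_
  · intro y
    rw [if_neg (by tauto)]
  · rintro c' A' y l hA' ⟨l', hl⟩ hy ⟨h1, h2, h3⟩ hr -
    replace hr : c'.reg 23 = y := hr
    have hnd := hin.nodup x
    rw [hl, List.nodup_append, List.nodup_cons] at hnd
    have hyx : y ∈ nb x := by rw [hl]; simp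
    have hyl : y ∉ l := hnd.2.1.1
    have hyS : y ∈ A'.S ↔ y ∈ A.S := by rw [h2, if_neg (by simp)]
    have hO : A'.O = A.O := by rw [h1]
    refine Does.eff_seq (.add (by omega) (by rw [hr, hA'.r3]; omega)) ?_
    refine Does.eff_seq (.load (by omega)) ?_
    refine Does.eff_seq (.add (by omega) ?_) ?_
    · simp [hr, hA'.r4]; omega
    refine Does.eff_seq (.load (by omega)) ?_
    refine Does.eff_seq (.sub (by omega)) ?_
    refine Does.eff_seq (.sub (by omega)) ?_
    refine Does.eff_seq (.add (by omega) ?_) ?_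
    · simp [hr, hA'.r4, hA'.r3, hA'.mem, layout_S hy, layout_O hy]
      split_ifs <;> omega
    refine Does.ite (fun h => ?_) (fun h => ?_)
    · have hd : ¬ (y ∈ A.O ↔ y ∈ A.S) := by
        intro h'
        simp [hr, hA'.r4, hA'.r3, hA'.mem, layout_S hy, layout_O hy, hO, hyS, h'] at h
      refine Does.eff_seq (.const (by omega) (by omega)) ?_
      refine Does.mono (does_flip (a := 23) hin (A := { A' with ok := 0 })
        (hA'.change_ok rfl rfl (fun r hr hr' => ?_) ?_) (x := y) ?_ hy (by omega)) (by omega)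
        le_rfl ?_
      · simp [hr', update_of_lt hr]
      · simp
      · simp [hr]
      rintro _ rfl
      refine ⟨?_, fun z => ?_, ?_⟩
      · dsimp only; rw [h1]
      · rw [Finset.mem_symmDiff, Finset.mem_singleton]
        by_cases hzy : z = y
        · subst hzy
          rw [if_pos ⟨hyx, hyl⟩, hyS]
          tauto
        · have := h2 z
          simp only [List.mem_cons, hzy, false_or, not_false_eq_true, and_true, false_and,
            or_false] at this ⊢
          exact this
      · rw [← h3]
        simp [hd]
    · have hd : y ∈ A.O ↔ y ∈ A.S := by
        by_cases p : y ∈ A.O <;> by_cases q : y ∈ A.S <;>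
          simp [hr, hA'.r4, hA'.r3, hA'.mem, layout_S hy, layout_O hy, hO, hyS, p, q] at h ⊢
      refine Does.le (Does.eff .skip (hA'.of_agree rfl rfl fun r hr => ?_) ⟨h1, fun z => ?_, ?_⟩)
        le_rfl (by omega)
      · simp [update_of_lt hr]
      · by_cases hzy : z = y
        · subst hzy
          rw [if_pos ⟨hyx, hyl⟩, hyS, hd]
        · have := h2 z
          simpa only [List.mem_cons, hzy, false_or] using this
      · rw [← h3]
        simp [hd]
  · rintro A' ⟨h1, h2, h3⟩
    refine ⟨h1, fun y => by rw [h2]; simp, by rw [← h3]; simp⟩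

end subprograms

/-! ### Moves in the search tree -/

/-- go from a node to its first child -/
def descend : Prog :=
  .add 12 5 6 ;; .load 12 12 ;; .add 13 2 12 ;; .const 14 0 ;; .store 13 14 ;; .add 6 6 0 ;;
    dominated 12 ;; .ite 8 .skip (flip 12)

/-- go from a node to its second child, with new vertex `reg 12`, if there is one -/
def trySecond : Prog :=
  -- The candidate is built and tested for maximality, then its parent is computed and compared with
  -- the saved set. This restores the node in either case, after which a successful candidate is
  -- built again.
  clear 12 ;; flip 12 ;; .const 7 1 ;; checkMaximal 12 ;; flip 12 ;; completeNbrs 12 ;;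
    restore 12 ;; .ite 7 (clear 12 ;; flip 12 ;; .add 13 2 12 ;; .const 14 0 ;; .store 13 14 ;;
      .add 6 6 0 ;; .const 9 1) .skip

/-- go from a child to its parent, or its next sibling -/
def ascend : Prog :=
  .sub 6 6 0 ;; .add 12 5 6 ;; .load 12 12 ;; .add 13 2 12 ;; .store 13 0 ;; .add 13 3 12 ;;
    -- A child containing `v` is the last one of its parent; a child avoiding `v` is the first one
    -- and equals its parent, so that only then a sibling has to be sought.
    .load 13 13 ;; .ite 13 (flip 12 ;; completeNbrs 12) trySecond

/-- The data `A` are at node `S` of level `i`, with vertex set `U` and order `o`, in direction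
`dir`. -/
structure Data.At (A : Data) (U S : Finset ℕ) (o : ℕ → ℕ) (i dir : ℕ) : Prop where
  U : A.U = U
  S : A.S = S
  o : A.o = o
  i : A.i = i
  dir : A.dir = dir

section steps
variable {n b Δ M : ℕ} {nb : ℕ → List ℕ} {inp : ℕ → ℕ} {c : Config} {A : Data} {v i : ℕ}
  {U S : Finset ℕ} {o : ℕ → ℕ}

theorem symmDiff_singleton_of_notMem {S : Finset ℕ} (h : v ∉ S) :
    symmDiff S {v} = insert v S := by
  ext z
  rw [Finset.mem_symmDiff, Finset.mem_singleton, Finset.mem_insert]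
  constructor
  · rintro (h | h)
    exacts [.inr h.1, .inl h.1]
  · rintro (rfl | h')
    · exact .inr ⟨rfl, h⟩
    · exact .inl ⟨h', fun hz => h (hz ▸ h')⟩

theorem symmDiff_singleton_of_mem {S : Finset ℕ} (h : v ∈ S) :
    symmDiff S {v} = S.erase v := by
  ext z
  rw [Finset.mem_symmDiff, Finset.mem_singleton, Finset.mem_erase]
  constructor
  · rintro (h' | ⟨rfl, h'⟩)
    exacts [⟨h'.2, h'.1⟩, absurd h h']
  · exact fun h => .inl ⟨h.2, h.1⟩

theorem does_descend (hin : Input n b Δ M nb inp) (hA : Rep n b inp c A) (h : A.At U S o i 1)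
    (hi : i < n) (hv : o i = v) (hvn : v < n) (hvS : v ∉ S) :
    Does n b M inp 12 (Δ * 14 + 38) descend c
      (Data.At · (insert v U) (childA nb v S) o (i + 1) 1) := by
  have hroom := hin.room
  obtain ⟨rfl, rfl, rfl, rfl, hdir⟩ := h
  refine Does.eff_seq (.add (by omega) (by rw [hA.r5, hA.r6]; omega)) ?_
  have e2 : layout n b inp A (b + n + n + n + A.i) = v := by rw [layout_o hi, hv]
  refine Does.eff_seq (.load (by omega)) ?_
  refine Does.eff_seq (.add (by omega) ?_) ?_
  · simp [hA.r5, hA.r6, hA.mem, e2, hA.r2]; omega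
  refine Does.eff_seq (.const (by omega) (by omega)) ?_
  refine Does.eff_seq (.store ?_) ?_
  · simp [hA.r5, hA.r6, hA.mem, e2, hA.r2]; omega
  refine Does.eff_seq (.add (by omega) ?_) ?_
  · simp [hA.r6, hA.r0]; omega
  refine Does.le (k := 13) (t := (Δ * 14 + 15) + 10 + 1) ?_ (by omega) (by omega)
  refine Does.seq (t₁ := Δ * 14 + 15) (t₂ := 10) (Does.le (does_dominated (a := 12) (x := v)
    (A := { A with U := insert v A.U, i := A.i + 1 }) hin ?_ ?_ hvn
    (by omega) (by omega)) (by omega) le_rfl) ?_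
  · constructor
    any_goals simp [hA.mem, e2, hA.r2, hA.cur, hA.r0, hA.r1, hA.r3, hA.r4, hA.r5, hA.r6,
      hA.r7, hA.r8, hA.r9]
    exact update_layout_insert_U hvn
  · simp [hA.r5, hA.r6, hA.mem, e2]
  rintro c1 _ hA1 rfl hf1
  have h12 : c1.reg 12 = v := by
    rw [hf1 12 (by omega) (by omega)]
    simp [hA.r5, hA.r6, hA.mem, e2]
  have h8 := hA1.r8
  dsimp only at h8
  simp only [hvS, false_or] at h8
  refine Does.ite (fun h => ?_) (fun h => ?_)
  · have h' : ¬ ∀ y ∈ nb v, y ∉ A.S := by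
      intro h'
      rw [if_neg (by push Not; exact h')] at h8
      omega
    exact Does.le (Does.eff .skip hA1 ⟨rfl, (if_neg h').symm, rfl, rfl, hdir⟩) le_rfl (by omega)
  · have h' : ∀ y ∈ nb v, y ∉ A.S := by
      by_contra h'
      rw [if_pos (by push Not at h'; exact h')] at h8
      omega
    refine Does.mono (does_flip (a := 12) hin hA1 (x := v) h12 hvn (by omega)) (by omega) le_rfl ?_
    rintro _ rfl
    refine ⟨rfl, ?_, rfl, rfl, hdir⟩
    rw [childA, if_pos h']
    exact symmDiff_singleton_of_notMem hvS

/-- The hypothesis `hit` is available because the search comes from a child avoiding `v`, which by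
maximality contains a neighbour of `v`. -/
theorem does_trySecond (hin : Input n b Δ M nb inp) (hA : Rep n b inp c A) (h : A.At U S o i 0)
    (hi : i < n) (h12 : c.reg 12 = v) (hvn : v < n) (hvU : v ∉ U) (hS : MIS nb U S)
    (hit : ∃ w ∈ nb v, w ∈ S) :
    Does n b M inp 12 (Δ * (Δ * (Δ * 14 + 31) + 19) + Δ * (Δ * 14 + 39) + Δ * 86 + 102)
      trySecond c fun A' =>
        HasB nb U v S ∧ A'.At (insert v U) (childB nb v S) o (i + 1) 1 ∨
        ¬ HasB nb U v S ∧ A'.At U S o i 0 := by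
  have hroom := hin.room
  obtain ⟨rfl, rfl, rfl, rfl, hdir⟩ := h
  have hvS : v ∉ A.S := fun h => hvU (hS.1 h)
  set X := A.S.filter (· ∉ nb v) with hX
  have hvX : v ∉ X := fun h => hvS (Finset.mem_filter.1 h).1
  have hB : symmDiff X {v} = childB nb v A.S := symmDiff_singleton_of_notMem hvX
  refine Does.le (k := 13) (t := Δ * (Δ * (Δ * 14 + 31) + 19) + Δ * (Δ * 14 + 39) + Δ * 86 + 102)
    ?_ (by omega) (by omega)
  · refine Does.seq_le (Δ * (Δ * (Δ * 14 + 31) + 19) + Δ * (Δ * 14 + 39) + Δ * 60 + 90) (Does.le (does_clear (a := 12) hin hA h12 hvn) (by omega) le_rfl) (by omega) ?_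
    rintro c1 A1 hA1 ⟨h1, hO⟩ hf1
    have h12' := (hf1 12 (by omega) (by omega)).trans h12
    refine Does.seq_le (Δ * (Δ * (Δ * 14 + 31) + 19) + Δ * (Δ * 14 + 39) + Δ * 60 + 80) (Does.le (does_flip (a := 12) hin hA1 h12' hvn (by omega)) (by omega)
      le_rfl) (by omega) ?_
    rintro c2 A2 hA2 h2 hf2
    replace h12' := (hf2 12 (by omega) (by omega)).trans h12'
    refine Does.eff_seq (.const (by omega) (by omega)) ?_
    refine Does.seq_le (Δ * (Δ * 14 + 39) + Δ * 60 + 66) (Does.le (does_checkMaximal (a := 12) (x := v) (A := { A2 with ok := 1 }) hin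
      (hA2.change_ok rfl rfl (fun r hr hr' => ?_) ?_) ?_ hvn) (by omega) le_rfl) (by omega) ?_
    · simp [hr']
    · simp
    · simpa using h12'
    rintro c3 A3 hA3 ⟨h3, hok⟩ hf3
    replace h12' : c3.reg 12 = v := by
      rw [hf3 12 (by omega) (by omega)]
      simpa using h12'
    refine Does.seq_le (Δ * (Δ * 14 + 39) + Δ * 60 + 56) (Does.le (does_flip (a := 12) hin hA3 h12' hvn (by omega)) (by omega)
      le_rfl) (by omega) ?_
    rintro c4 A4 hA4 h4 hf4
    replace h12' := (hf4 12 (by omega) (by omega)).trans h12'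
    refine Does.seq_le (Δ * 60 + 44) (Does.le (does_completeNbrs (a := 12) hin hA4 h12' hvn) (by omega) le_rfl) (by omega) ?_
    rintro c5 A5 hA5 h5 hf5
    replace h12' := (hf5 12 (by omega) (by omega)).trans h12'
    refine Does.seq_le (Δ * 26 + 32) (Does.le (does_restore (a := 12) hin hA5 h12' hvn) (by omega) le_rfl) (by omega) ?_
    rintro c6 A6 hA6 ⟨h6, hS6, hok6⟩ hf6
    replace h12' := (hf6 12 (by omega) (by omega)).trans h12'
    have eU : A6.U = A.U := calc A6.U = A5.U := by rw [h6]
        _ = A4.U := by rw [h5]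
        _ = A3.U := by rw [h4]
        _ = A2.U := by rw [h3]
        _ = A1.U := by rw [h2]
        _ = A.U := by rw [h1]
    have eo : A6.o = A.o := calc A6.o = A5.o := by rw [h6]
        _ = A4.o := by rw [h5]
        _ = A3.o := by rw [h4]
        _ = A2.o := by rw [h3]
        _ = A1.o := by rw [h2]
        _ = A.o := by rw [h1]
    have ei : A6.i = A.i := calc A6.i = A5.i := by rw [h6]
        _ = A4.i := by rw [h5]
        _ = A3.i := by rw [h4]
        _ = A2.i := by rw [h3]
        _ = A1.i := by rw [h2]
        _ = A.i := by rw [h1]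
    have edir : A6.dir = A.dir := calc A6.dir = A5.dir := by rw [h6]
        _ = A4.dir := by rw [h5]
        _ = A3.dir := by rw [h4]
        _ = A2.dir := by rw [h3]
        _ = A1.dir := by rw [h2]
        _ = A.dir := by rw [h1]
    have eS1 : A1.S = X := by rw [h1]
    have eU1 : A1.U = A.U := by rw [h1]
    have eS2 : A2.S = childB nb v A.S := by rw [h2, ← hB, ← eS1]
    have eU2 : A2.U = A.U := by rw [h2, ← eU1]
    have eS3 : A3.S = childB nb v A.S := by rw [h3]; exact eS2
    have eU3 : A3.U = A.U := by rw [h3]; exact eU2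
    have eS4 : A4.S = X := by
      rw [h4]
      show symmDiff A3.S {v} = X
      rw [eS3, ← hB, symmDiff_symmDiff_cancel_right]
    have eU4 : A4.U = A.U := by rw [h4]; exact eU3
    have eS5 : A5.S = complete nb A.U X (nb v) := by rw [h5, ← eU4, ← eS4]
    have eO5 : A5.O = A1.O := calc A5.O = A4.O := by rw [h5]
        _ = A3.O := by rw [h4]
        _ = A2.O := by rw [h3]
        _ = A1.O := by rw [h2]
    have eok5 : A5.ok = A3.ok := calc A5.ok = A4.ok := by rw [h5]
        _ = A3.ok := by rw [h4]
    -- Outside `nb v` the recomputed parent agrees with the node automatically, so comparing it on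
    -- `nb v` suffices.
    have off : ∀ y, y ∉ nb v → (y ∈ A5.S ↔ y ∈ A.S) := by
      intro y hy
      rw [eS5]
      constructor
      · intro h
        rcases mem_of_mem_complete _ h with h | h
        exacts [(Finset.mem_filter.1 h).1, absurd h.2 hy]
      · exact fun h => subset_complete _ (Finset.mem_filter.2 ⟨h, hy⟩)
    have eS : A6.S = A.S := by
      ext y
      rw [hS6]
      split_ifs with hy
      · rw [eO5, hO y hy]
      · exact off y hy
    -- The flag survives exactly if both tests succeed; together with `hit` these are the three
    -- conditions in `HasB`.
    have hok' : A6.ok ≠ 0 ↔ HasB nb A.U v A.S := by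
      rw [hok6, eok5, hok, HasB, mis_childB_iff hin.symm hin.irrefl hvU hS]
      simp only [eU2, eS2, ne_eq, one_ne_zero, not_false_eq_true, true_and, hit]
      refine and_congr_right fun _ => ⟨fun h => ?_, fun h y hy => ?_⟩
      · rw [← hX, ← eS5]
        ext y
        by_cases hy : y ∈ nb v
        · rw [← h y hy, eO5, hO y hy]
        · exact off y hy
      · rw [eO5, hO y hy, eS5, hX, h]
    refine Does.ite (fun h => ?_) (fun h => ?_)
    · have hHas := hok'.1 (by rw [← hA6.r7]; exact h)
      refine Does.seq_le 19 (Does.le (does_clear (a := 12) hin hA6 h12' hvn) (by omega) le_rfl) (by omega) ?_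
      rintro c7 A7 hA7 ⟨h7, -⟩ hf7
      replace h12' := (hf7 12 (by omega) (by omega)).trans h12'
      refine Does.seq_le 9 (Does.le (does_flip (a := 12) hin hA7 h12' hvn (by omega)) (by omega)
        le_rfl) (by omega) ?_
      rintro c8 A8 hA8 h8 hf8
      replace h12' := (hf8 12 (by omega) (by omega)).trans h12'
      have eS7 : A7.S = X := by rw [h7, hX, ← eS]
      have eS8 : A8.S = childB nb v A.S := by rw [h8, ← hB, ← eS7]
      have eU8 : A8.U = A.U :=
        (congrArg Data.U h8).trans ((congrArg Data.U h7).trans eU)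
      have eo8 : A8.o = A.o :=
        (congrArg Data.o h8).trans ((congrArg Data.o h7).trans eo)
      have ei8 : A8.i = A.i :=
        (congrArg Data.i h8).trans ((congrArg Data.i h7).trans ei)
      refine Does.eff_seq (.add (by omega) (by rw [hA8.r2, h12']; omega)) ?_
      refine Does.eff_seq (.const (by omega) (by omega)) ?_
      refine Does.eff_seq (.store ?_) ?_
      · simp [hA8.r2, h12']; omega
      refine Does.eff_seq (.add (by omega) ?_) ?_
      · simp [hA8.r6, hA8.r0, ei8]; omega
      refine Does.eff (A' := { A8 with U := insert v A8.U, i := A8.i + 1, dir := 1 })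
        (.const (by omega) (by omega)) ?_ (.inl ⟨hHas, ?_⟩)
      · constructor
        any_goals simp [hA8.mem, hA8.r2, hA8.cur, hA8.r0, hA8.r1, hA8.r3, hA8.r4,
          hA8.r5, hA8.r6, hA8.r7, hA8.r8, h12']
        exact update_layout_insert_U hvn
      · exact ⟨by rw [eU8], eS8, eo8, by rw [ei8], rfl⟩
    · refine Does.le (t := 1) (Does.eff .skip hA6 (.inr ⟨?_, ?_⟩)) le_rfl (by omega)
      · rw [← hok', ← hA6.r7, h]; simp
      · exact ⟨eU, eS, eo, ei, edir.trans hdir⟩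

theorem does_ascend (hin : Input n b Δ M nb inp) (hA : Rep n b inp c A)
    (h : A.At (insert v U) S o (i + 1) 0)
    (hi : i < n) (hv : o i = v) (hvn : v < n) (hvU : v ∉ U) (hS : MIS nb (insert v U) S) :
    Does n b M inp 12 (Δ * (Δ * (Δ * 14 + 31) + 19) + Δ * (Δ * 14 + 39) + Δ * 86 + 117)
      ascend c fun A' =>
        v ∉ S ∧ HasB nb U v S ∧ A'.At (insert v U) (childB nb v S) o (i + 1) 1 ∨
        ¬ (v ∉ S ∧ HasB nb U v S) ∧ A'.At U (parent nb U v S) o i 0 := by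
  have hroom := hin.room
  obtain ⟨hU, rfl, rfl, hi', hdir⟩ := h
  have e2 : layout n b inp A (b + n + n + n + i) = v := by rw [layout_o hi, hv]
  refine Does.eff_seq (.sub (by omega)) ?_
  refine Does.eff_seq (.add (by omega) ?_) ?_
  · simp [hA.r5, hA.r6, hA.r0, hi']; omega
  refine Does.eff_seq (.load (by omega)) ?_
  refine Does.eff_seq (.add (by omega) ?_) ?_
  · simp [hA.r5, hA.r6, hA.r0, hi', hA.mem, e2, hA.r2]; omega
  refine Does.eff_seq (.store ?_) ?_
  · simp [hA.r5, hA.r6, hA.r0, hi', hA.mem, e2, hA.r2]; omega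
  refine Does.eff_seq (.add (by omega) ?_) ?_
  · simp [hA.r5, hA.r6, hA.r0, hi', hA.mem, e2, hA.r3]; omega
  refine Does.eff_seq (.load (by omega)) ?_
  have hUe : A.U.erase v = U := by rw [hU, Finset.erase_insert hvU]
  have hR : ∀ c' : Config, c'.mem = Function.update c.mem (b + v) 1 → c'.cur = c.cur →
      (∀ r < 10, r ≠ 6 → c'.reg r = c.reg r) → c'.reg 6 = i →
      Rep n b inp c' { A with U := U, i := i } := by
    intro c' hm hc hr h6
    constructor
    · rw [hm, hA.mem, update_layout_erase_U hvn, hUe]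
      exact layout_congr rfl rfl rfl rfl
    · exact hc.trans hA.cur
    any_goals exact h6
    all_goals rw [hr _ (by norm_num) (by norm_num)]
    exacts [hA.r0, hA.r1, hA.r2, hA.r3, hA.r4, hA.r5, hA.r7, hA.r8, hA.r9]
  have e3 : Function.update (layout n b inp A) (b + v) 1 (b + n + v) =
      if v ∈ A.S then 1 else 0 := by
    rw [Function.update_of_ne (by omega), layout_S hvn]
  refine Does.ite (fun h => ?_) (fun h => ?_)
  · have hvS : v ∈ A.S := by
      by_contra h'
      simp [hA.r5, hA.r6, hA.r0, hi', hA.mem, e2, hA.r3, hA.r2, e3, h'] at h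
    refine Does.le (k := 13) (t := 9 + (Δ * (Δ * 14 + 39) + 11) + 1) ?_ (by omega) (by omega)
    refine Does.seq (Does.le (does_flip (a := 12) (x := v) hin (hR _ ?_ rfl (fun r hr hr' => ?_) ?_)
      ?_ hvn (by omega)) (by omega) le_rfl) ?_
    · simp [hA.r5, hA.r6, hA.r0, hi', hA.mem, e2, hA.r2]
    · simp [hr', update_of_lt hr]
    · simp [hA.r6, hA.r0, hi']
    · simp [hA.r5, hA.r6, hA.r0, hi', hA.mem, e2]
    rintro c1 _ hA1 rfl hf1
    refine Does.mono (does_completeNbrs (a := 12) (x := v) hin hA1 ?_ hvn) (by omega) le_rfl ?_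
    · rw [hf1 12 (by omega) (by omega)]
      simp [hA.r5, hA.r6, hA.r0, hi', hA.mem, e2]
    · rintro A' h'
      refine .inr ⟨fun h => h.1 hvS, ?_⟩
      rw [h', parent, if_pos hvS, ← symmDiff_singleton_of_mem hvS]
      exact ⟨rfl, rfl, rfl, rfl, hdir⟩
  · have hvS : v ∉ A.S := by
      intro h'
      simp [hA.r5, hA.r6, hA.r0, hi', hA.mem, e2, hA.r3, hA.r2, e3, h'] at h
    have hpar : parent nb U v A.S = A.S := if_neg hvS
    have hS' := parent_mis hin.symm hin.irrefl hvU hS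
    rw [hpar] at hS' ⊢
    have hit : ∃ w ∈ nb v, w ∈ A.S := by
      by_contra! h'
      exact hvS ((hS.2 v (Finset.mem_insert_self _ _)).2 h')
    refine Does.mono (does_trySecond (v := v) (A := { A with U := U, i := i }) hin
      (hR _ ?_ rfl (fun r hr hr' => ?_) ?_) ⟨rfl, rfl, rfl, rfl, hdir⟩ hi ?_ hvn hvU hS' hit) le_rfl
      (by omega) ?_
    · simp [hA.r5, hA.r6, hA.r0, hi', hA.mem, e2, hA.r2]
    · simp [hr', update_of_lt hr]
    · simp [hA.r6, hA.r0, hi']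
    · simp [hA.r5, hA.r6, hA.r0, hi', hA.mem, e2]
    · rintro A' (h | h)
      exacts [.inl ⟨hvS, h⟩, .inr ⟨fun h' => h.1 h'.2, h.2⟩]

end steps

/-! ### Preparation: peeling off neighbourhoods of edges -/

/-- give vertex `reg a` the highest free position -/
def place (a : ℕ) : Prog :=
  .sub 6 6 0 ;; .add 36 5 6 ;; .store 36 a

/-- remove the neighbours of `reg a` from `U`, placing them -/
def removeNbrs (a : ℕ) : Prog :=
  forNbrs 30 a (.add 34 2 33 ;; .load 35 34 ;; .ite 35 .skip (.store 34 0 ;; place 33))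

/-- if both ends `reg 12` and `reg 23` of an edge are in `U`, remove all their neighbours -/
def peelEdge : Prog :=
  -- The flags are 0 for members of `U`, so their sum vanishes exactly when both ends are present.
  .add 24 2 12 ;; .load 24 24 ;; .add 25 2 23 ;; .load 25 25 ;; .add 24 24 25 ;;
    .ite 24 .skip (removeNbrs 12 ;; removeNbrs 23)

/-- set up the registers and remove the neighbours of edges from `U` until no edge is left -/
def peel : Prog :=
  .const 0 1 ;; .load 1 10 ;; .add 10 1 0 ;; .load 2 10 ;; .add 3 2 1 ;; .add 4 3 1 ;;
    .add 5 4 1 ;; .copy 6 1 ;; .copy 13 1 ;; forRange 12 (forNbrs 20 12 peelEdge)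

/-- place the vertices of `U` and insert them into the current set -/
def fill : Prog :=
  .const 12 0 ;; .copy 13 1 ;;
    forRange 12 (.add 14 2 12 ;; .load 14 14 ;; .ite 14 .skip (flip 12 ;; place 12))

/-- everything that precedes the enumeration -/
def prepare : Prog :=
  -- Placing the remaining vertices counts register `6` down to 0; register `10` keeps the root
  -- level `r`, below which the search never goes.
  peel ;; .copy 10 6 ;; fill ;; .copy 6 10 ;; .const 9 1 ;; .const 11 1

/-- From position `i` on, `o` lists the vertices that lead from `V i` up to all vertices. -/
structure Chain (n : ℕ) (o : ℕ → ℕ) (V : ℕ → Finset ℕ) (i : ℕ) : Prop where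
  top : V n = Finset.range n
  le : i ≤ n
  step : ∀ j, i ≤ j → j < n → o j ∉ V j ∧ V (j + 1) = insert (o j) (V j)

section Chain
variable {n i j : ℕ} {o : ℕ → ℕ} {V : ℕ → Finset ℕ}

/-- The level of a set in the chain is its size, so differences of levels count removed vertices. -/
theorem Chain.card (h : Chain n o V i) (hij : i ≤ j) (hj : j ≤ n) : (V j).card = j := by
  obtain ⟨d, hd⟩ := Nat.exists_eq_add_of_le hj
  induction d generalizing j with
  | zero => rw [← Nat.add_zero j, ← hd, h.top, Finset.card_range]
  | succ d ih =>
    have h1 := h.step j hij (by omega)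
    have h2 := ih (j := j + 1) (by omega) (by omega) (by omega)
    rw [h1.2, Finset.card_insert_of_notMem h1.1] at h2
    omega

theorem Chain.subset (h : Chain n o V i) {j' : ℕ} (hij : i ≤ j) (hjj : j ≤ j') (hj : j' ≤ n) :
    V j ⊆ V j' := by
  induction j', hjj using Nat.le_induction with
  | base => exact subset_rfl
  | succ m hm ih =>
    rw [(h.step m (by omega) (by omega)).2]
    exact (ih (by omega)).trans (Finset.subset_insert _ _)

theorem Chain.subset_range (h : Chain n o V i) (hij : i ≤ j) (hj : j ≤ n) :
    V j ⊆ Finset.range n := h.top ▸ h.subset hij hj le_rfl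

theorem Chain.lt (h : Chain n o V i) (hij : i ≤ j) (hj : j < n) : o j < n := by
  have := h.subset_range (j := j + 1) (by omega) hj
  rw [(h.step j hij hj).2] at this
  exact Finset.mem_range.1 (this (Finset.mem_insert_self _ _))

theorem Chain.pos (h : Chain n o V i) {x : ℕ} (hx : x ∈ V i) : 0 < i := by
  rw [← h.card le_rfl h.le]
  exact Finset.card_pos.2 ⟨x, hx⟩

/-- The chain grows downwards: the removed vertex is the one that leads back from the new bottom set
to the old one. -/
theorem Chain.place (h : Chain n o V i) {x : ℕ} (hx : x ∈ V i) :
    Chain n (Function.update o (i - 1) x) (Function.update V (i - 1) ((V i).erase x)) (i - 1) := by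
  have hi := h.pos hx
  have hn := h.le
  refine ⟨?_, by omega, fun j hj hj' => ?_⟩
  · rw [Function.update_of_ne (by omega), h.top]
  · by_cases hji : j = i - 1
    · subst hji
      rw [Function.update_self, Function.update_self, Function.update_of_ne (by omega),
        Nat.sub_add_cancel hi, Finset.insert_erase hx]
      exact ⟨Finset.notMem_erase _ _, rfl⟩
    · rw [Function.update_of_ne hji, Function.update_of_ne hji, Function.update_of_ne (by omega)]
      exact h.step j (by omega) hj'

end Chain

section prepare
variable {n b Δ M : ℕ} {nb : ℕ → List ℕ} {inp : ℕ → ℕ} {c : Config} {A : Data} {a x y : ℕ}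

theorem does_place (hin : Input n b Δ M nb inp) (hA : Rep n b inp c A) (ha : c.reg a = x)
    (ha' : a < 36) (ha2 : 10 ≤ a) (hi : 0 < A.i) (hi' : A.i ≤ n) :
    Does n b M inp 36 5 (place a) c
      (· = { A with o := Function.update A.o (A.i - 1) x, i := A.i - 1 }) := by
  have hroom := hin.room
  have h1 : a ≠ 6 := by omega
  have h2 : a ≠ 36 := by omega
  refine Does.eff_seq (.sub (by omega)) ?_
  refine Does.eff_seq (.add (by omega) ?_) ?_
  · simp [hA.r5, hA.r6, hA.r0]; omega
  refine Does.eff (A' := { A with o := Function.update A.o (A.i - 1) x, i := A.i - 1 })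
    (.store ?_) ?_ rfl
  · simp [hA.r5, hA.r6, hA.r0]; omega
  · constructor
    any_goals simp [hA.mem, hA.r2, hA.cur, hA.r0, hA.r1, hA.r3, hA.r4, hA.r5, hA.r6,
      hA.r7, hA.r8, hA.r9, ha, h1, h2]
    rw [update_layout_o (by omega)]
    exact layout_congr rfl rfl rfl rfl

theorem does_removeNbrs (hin : Input n b Δ M nb inp) (hA : Rep n b inp c A) (ha : c.reg a = y)
    (hy : y < n) {V : ℕ → Finset ℕ} (hV : Chain n A.o V A.i) (hU : V A.i = A.U) :
    Does n b M inp 30 (Δ * 20 + 11) (removeNbrs a) c fun A' =>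
      ∃ V', Chain n A'.o V' A'.i ∧ V' A'.i = A'.U ∧ A'.i ≤ A.i ∧ (∀ j, A.i ≤ j → V' j = V j) ∧
        A'.S = A.S ∧ A'.U = A.U.filter (· ∉ nb y) := by
  have hroom := hin.room
  refine (does_forNbrs (t := 12) (A := A) hin
    (Inv := fun l A' => ∃ V', Chain n A'.o V' A'.i ∧ V' A'.i = A'.U ∧ A'.i ≤ A.i ∧
      (∀ j, A.i ≤ j → V' j = V j) ∧ A'.S = A.S ∧
      ∀ x, x ∈ A'.U ↔ x ∈ A.U ∧ (x ∈ nb y → x ∈ l))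
    (by omega) ha hy hA ⟨V, hV, hU, le_rfl, fun _ _ => rfl, rfl, by simp⟩ ?_).mono le_rfl le_rfl ?_
  · rintro c' A' x l hA' ⟨l', hl⟩ hx ⟨V', hV', hU', hi, hVV, hS, h2⟩ hr -
    replace hr : c'.reg 33 = x := hr
    have hnd := hin.nodup y
    rw [hl, List.nodup_append, List.nodup_cons] at hnd
    have hxy : x ∈ nb y := by rw [hl]; simp
    refine Does.eff_seq (.add (by omega) (by rw [hr, hA'.r2]; omega)) ?_
    refine Does.eff_seq (.load (by omega)) ?_
    refine Does.ite (fun h => ?_) (fun h => ?_)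
    · have hxU : x ∉ A'.U := by
        intro h'
        simp [hr, hA'.r2, hA'.mem, layout_U hx, h'] at h
      refine Does.le (Does.eff .skip (hA'.of_agree rfl rfl fun r hr => ?_)
        ⟨V', hV', hU', hi, hVV, hS, fun z => ?_⟩) le_rfl (by omega)
      · simp [update_of_lt hr]
      · rw [h2]
        have := (h2 x).not.1 hxU
        simp only [List.mem_cons, true_or, implies_true, and_true] at this
        refine and_congr_right fun hz => imp_congr_right fun _ => ?_
        rw [List.mem_cons, or_iff_right]
        rintro rfl
        exact this hz
    · have hxU : x ∈ A'.U := by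
        by_contra h'
        simp [hr, hA'.r2, hA'.mem, layout_U hx, h'] at h
      have hpos := hV'.pos (hU' ▸ hxU)
      refine Does.eff_seq (.store ?_) ?_
      · simp [hr, hA'.r2]; omega
      refine Does.mono (does_place (a := 33) (x := x) (A := { A' with U := A'.U.erase x }) hin
        (hA'.change ?_ hA'.cur (fun r hr => ?_) rfl rfl rfl rfl) ?_ (by omega) (by omega) hpos
        hV'.le) (by omega) le_rfl ?_
      · simp [hr, hA'.r2, hA'.r0, hA'.mem, update_layout_erase_U hx]
      · simp [update_of_lt hr]
      · simp [hr]
      rintro _ rfl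
      refine ⟨_, hV'.place (hU' ▸ hxU), ?_, ?_, fun j hj => ?_, hS, fun z => ?_⟩
      · simp [hU']
      · exact (Nat.sub_le _ _).trans hi
      · rw [Function.update_of_ne (show j ≠ A'.i - 1 by omega), hVV j hj]
      · simp only [Finset.mem_erase, h2, List.mem_cons]
        constructor
        · rintro ⟨h1, h3, h4⟩
          exact ⟨h3, fun h => (h4 h).resolve_left h1⟩
        · rintro ⟨h1, h4⟩
          refine ⟨?_, h1, fun h => .inr (h4 h)⟩
          rintro rfl
          exact hnd.2.1.1 (h4 hxy)
  · rintro A' ⟨V', h1, h2, h3, h4, h5, h6⟩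
    refine ⟨V', h1, h2, h3, h4, h5, ?_⟩
    ext z
    rw [h6, Finset.mem_filter]
    simp

/-- The state of the peeling phase: the removed vertices are placed, and they pay for the numbers
of maximal independent sets on their levels. -/
def Peeled (n Δ : ℕ) (nb : ℕ → List ℕ) (A : Data) : Prop :=
  ∃ V, Chain n A.o V A.i ∧ V A.i = A.U ∧ A.S = ∅ ∧
    ∑ j ∈ Finset.Ico A.i n, num nb (V (j + 1)) + 4 * Δ * num nb A.U ≤
      4 * Δ * num nb (Finset.range n)

/-- An amortized estimate with potential `4 * Δ * num nb U`. The new levels number at most `2 * Δ`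
and each contributes at most `num nb A.U`; since the count for `U` is at least halved, the potential
drops by at least `2 * Δ * num nb A.U`, which pays for them. -/
theorem Peeled.remove (hin : Input n b Δ M nb inp) {A' : Data} {V V' : ℕ → Finset ℕ} {u w : ℕ}
    (hV : Chain n A.o V A.i) (hU : V A.i = A.U)
    (hpot : ∑ j ∈ Finset.Ico A.i n, num nb (V (j + 1)) + 4 * Δ * num nb A.U ≤
      4 * Δ * num nb (Finset.range n))
    (hu : u ∈ A.U) (hw : w ∈ A.U) (huw : w ∈ nb u)
    (hV' : Chain n A'.o V' A'.i) (hU' : V' A'.i = A'.U) (hi : A'.i ≤ A.i)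
    (hVV : ∀ j, A.i ≤ j → V' j = V j) (hS : A'.S = ∅)
    (hUU : ∀ x, x ∈ A'.U ↔ x ∈ A.U ∧ x ∉ nb u ∧ x ∉ nb w) : Peeled n Δ nb A' := by
  refine ⟨V', hV', hU', hS, ?_⟩
  have h2 := two_mul_num_le hin.symm hin.irrefl hu hw huw hUU
  have hle := hV.le
  have e1 : ∑ j ∈ Finset.Ico A.i n, num nb (V' (j + 1)) =
      ∑ j ∈ Finset.Ico A.i n, num nb (V (j + 1)) :=
    Finset.sum_congr rfl fun j hj => by rw [hVV _ (by rw [Finset.mem_Ico] at hj; omega)]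
  have e2 : ∑ j ∈ Finset.Ico A'.i A.i, num nb (V' (j + 1)) ≤ (A.i - A'.i) * num nb A.U := by
    rw [← Nat.card_Ico, ← smul_eq_mul]
    refine Finset.sum_le_card_nsmul _ _ _ fun j hj => num_mono hin.symm hin.irrefl ?_
    rw [Finset.mem_Ico] at hj
    rw [← hU, ← hVV _ le_rfl]
    exact hV'.subset (by omega) (by omega) hle
  have e3 : A.i - A'.i ≤ 2 * Δ := by
    have c1 := hV.card le_rfl hle
    have c2 := hV'.card le_rfl (by omega)
    rw [hU] at c1
    rw [hU'] at c2
    have : A.U ⊆ A'.U ∪ ((nb u).toFinset ∪ (nb w).toFinset) := by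
      intro x hx
      simp only [Finset.mem_union, hUU, List.mem_toFinset]
      tauto
    have := (Finset.card_le_card this).trans (Finset.card_union_le _ _)
    have := Finset.card_union_le (nb u).toFinset (nb w).toFinset
    have := List.toFinset_card_le (nb u)
    have := List.toFinset_card_le (nb w)
    have := hin.deg u
    have := hin.deg w
    omega
  rw [← Finset.sum_Ico_consecutive _ hi hle, e1]
  have e4 := Nat.mul_le_mul_right (num nb A.U) e3
  nlinarith [Nat.mul_le_mul_left (2 * Δ) h2]

theorem does_peelEdge (hin : Input n b Δ M nb inp) (hA : Rep n b inp c A) {u w : ℕ}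
    (hu : c.reg 12 = u) (hw : c.reg 23 = w) (hun : u < n) (hwn : w < n) (huw : w ∈ nb u)
    (hP : Peeled n Δ nb A) :
    Does n b M inp 24 (Δ * 40 + 34) peelEdge c fun A' =>
      Peeled n Δ nb A' ∧ A'.U ⊆ A.U ∧ ¬ (u ∈ A'.U ∧ w ∈ A'.U) := by
  have hroom := hin.room
  refine Does.eff_seq (.add (by omega) (by rw [hu, hA.r2]; omega)) ?_
  refine Does.eff_seq (.load (by omega)) ?_
  refine Does.eff_seq (.add (by omega) ?_) ?_
  · simp [hw, hA.r2]; omega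
  refine Does.eff_seq (.load (by omega)) ?_
  refine Does.eff_seq (.add (by omega) ?_) ?_
  · simp [hu, hw, hA.r2, hA.mem, layout_U hun, layout_U hwn]
    split_ifs <;> omega
  refine Does.ite (fun h => ?_) (fun h => ?_)
  · refine Does.le (Does.eff .skip (hA.of_agree rfl rfl fun r hr => ?_)
      ⟨hP, subset_rfl, fun h' => ?_⟩) le_rfl (by omega)
    · simp [update_of_lt hr]
    · simp [hu, hw, hA.r2, hA.mem, layout_U hun, layout_U hwn, h'] at h
  · have h' : u ∈ A.U ∧ w ∈ A.U := by
      by_cases p : u ∈ A.U <;> by_cases q : w ∈ A.U <;>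
        simp [hu, hw, hA.r2, hA.mem, layout_U hun, layout_U hwn, p, q] at h ⊢
    obtain ⟨V, hV, hU, hS, hpot⟩ := hP
    refine Does.seq_le (k := 24) (t := Δ * 40 + 23) (t₁ := Δ * 20 + 11) (Δ * 20 + 11)
      (Does.le (k := 30) (does_removeNbrs (a := 12) (y := u) (A := A) hin
      ?_ ?_ hun hV hU) (by omega) le_rfl) (by omega) ?_
    · exact hA.of_agree rfl rfl fun r hr => by simp [update_of_lt hr]
    · simp [hu]
    rintro c1 A1 hA1 ⟨V1, hV1, hU1, hi1, hVV1, hS1, hUU1⟩ hf1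
    refine Does.mono (does_removeNbrs (a := 23) (y := w) (A := A1) hin hA1 ?_ hwn hV1 hU1)
      (by omega) le_rfl ?_
    · rw [hf1 23 (by omega) (by omega)]
      simp [hw]
    rintro A2 ⟨V2, hV2, hU2, hi2, hVV2, hS2, hUU2⟩
    have hUU : ∀ x, x ∈ A2.U ↔ x ∈ A.U ∧ x ∉ nb u ∧ x ∉ nb w := by
      intro x
      rw [hUU2, hUU1, Finset.mem_filter, Finset.mem_filter, and_assoc]
    refine ⟨Peeled.remove hin hV hU hpot h'.1 h'.2 huw hV2 hU2 (by omega)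
      (fun j hj => (hVV2 j (by omega)).trans (hVV1 j hj)) (by rw [hS2, hS1, hS]) hUU,
      fun x hx => ((hUU x).1 hx).1, fun h => ((hUU w).1 h.2).2.1 huw⟩

end prepare

section prepare
variable {n b Δ M : ℕ} {nb : ℕ → List ℕ} {inp : ℕ → ℕ} {c : Config} {A : Data}

/-- `U` only shrinks, so an edge that has lost an end never returns, and one pass over all edges
leaves `U` edgeless. -/
theorem does_peel (hin : Input n b Δ M nb inp) (hreg : ∀ r, c.reg r = 0) (hmem : c.mem = inp)
    (hcur : c.cur = ∅) (h0 : ∀ a, b ≤ a → inp a = 0) :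
    Does n b M inp 10 (n * (Δ * (Δ * 40 + 42) + 17) + 21) peel c fun A =>
      Peeled n Δ nb A ∧ ∀ u, ∀ w ∈ nb u, ¬ (u ∈ A.U ∧ w ∈ A.U) := by
  have hroom := hin.room
  have hle := hin.start_le
  refine Does.eff_seq (.const (by omega) (by omega)) ?_
  refine Does.eff_seq (.load (by omega)) ?_
  refine Does.eff_seq (.add (by omega) ?_) ?_
  · simp [hreg, hmem, hin.size]; omega
  refine Does.eff_seq (.load (by omega)) ?_
  refine Does.eff_seq (.add (by omega) ?_) ?_
  · simp [hreg, hmem, hin.size, hin.finish]; omega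
  refine Does.eff_seq (.add (by omega) ?_) ?_
  · simp [hreg, hmem, hin.size, hin.finish]; omega
  refine Does.eff_seq (.add (by omega) ?_) ?_
  · simp [hreg, hmem, hin.size, hin.finish]; omega
  refine Does.eff_seq (.copy (by omega)) ?_
  refine Does.eff_seq (.copy (by omega)) ?_
  refine Does.mono (does_forRange (k := 12) (t := Δ * (Δ * 40 + 34 + 8) + 11)
    (Inv := fun u A => Peeled n Δ nb A ∧ ∀ u' < u, ∀ w ∈ nb u', ¬ (u' ∈ A.U ∧ w ∈ A.U))
    -- The zeros behind the input already represent these data.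
    (A := ⟨Finset.range n, ∅, ∅, fun _ => 0, n, 0, 0, 0⟩) (i := 0) (e := n)
    (by omega) (by omega) (by omega) ?_ ?_ ?_ ⟨?_, ?_⟩ ?_) (by omega) (by
      rw [Nat.sub_zero]) ?_
  · simp [hreg]
  · simp [hreg, hmem, hin.size]
  · constructor
    any_goals simp [hreg, hmem, hin.size, hin.finish, hcur]
    funext a
    unfold layout
    split_ifs with h1 h2 h3 h4 h5 h6 h7 h8
    any_goals exact h0 a (by omega)
    · rfl
    · exact absurd (Finset.mem_range.2 (by omega)) h3
    · exact absurd h5 (Finset.notMem_empty _)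
    · exact absurd h7 (Finset.notMem_empty _)
  · refine ⟨fun _ => Finset.range n, ⟨rfl, le_rfl, fun j hj hj' => absurd hj' (not_lt.2 hj)⟩, rfl,
      rfl, ?_⟩
    simp
  · intro u' hu'
    exact absurd hu' (Nat.not_lt_zero _)
  · rintro c' A u - hu hA ⟨hP, hlt⟩ hr -
    refine Does.mono (does_forNbrs (k := 20) (t := Δ * 40 + 34) (A := A) hin
      (Inv := fun l A' => Peeled n Δ nb A' ∧ A'.U ⊆ A.U ∧
        ∀ w ∈ nb u, w ∈ l ∨ ¬ (u ∈ A'.U ∧ w ∈ A'.U))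
      (by omega) hr hu hA ⟨hP, subset_rfl, fun w hw => .inl hw⟩ ?_) (by omega) le_rfl ?_
    · rintro c1 A1 w l hA1 ⟨l', hl⟩ hw ⟨hP1, hsub, hor⟩ hr1 hf1
      refine Does.mono (does_peelEdge hin hA1 (u := u) (w := w) ?_ hr1 hu hw ?_ hP1) (by omega)
        le_rfl ?_
      · rw [hf1 12 (by omega) (by omega), hr]
      · rw [hl]; simp
      · rintro A2 ⟨hP2, hsub2, hnot⟩
        refine ⟨hP2, hsub2.trans hsub, fun w' hw' => ?_⟩
        rcases hor w' hw' with h | h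
        · rcases List.mem_cons.1 h with rfl | h
          exacts [.inr hnot, .inl h]
        · exact .inr fun h' => h ⟨hsub2 h'.1, hsub2 h'.2⟩
    · rintro A1 ⟨hP1, hsub, hor⟩
      refine ⟨hP1, fun u' hu' w hw h => ?_⟩
      rcases Nat.lt_succ_iff_lt_or_eq.1 hu' with h' | rfl
      · exact hlt u' h' w hw ⟨hsub h.1, hsub h.2⟩
      · exact (hor w hw).resolve_left (by simp) h
  · rintro A ⟨hP, hlt⟩
    refine ⟨hP, fun u w hw h => hlt u ?_ w hw h⟩
    exact hin.lt (hin.symm _ _ hw)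

/-- The vertices below `u` have been placed, so the bottom of the chain consists of the members of
`U` from `u` on. The set on the device becomes `U`, the root of the search. -/
theorem does_fill (hin : Input n b Δ M nb inp) (hA : Rep n b inp c A) {V : ℕ → Finset ℕ}
    (hV : Chain n A.o V A.i) (hU : V A.i = A.U) (hS : A.S = ∅) :
    Does n b M inp 12 (n * 26 + 7) fill c fun A' =>
      A'.U = A.U ∧ A'.S = A.U ∧ ∃ V', Chain n A'.o V' 0 ∧ ∀ j, A.i ≤ j → V' j = V j := by
  have hroom := hin.room
  have hUn : A.U ⊆ Finset.range n := hU ▸ hV.subset_range le_rfl hV.le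
  refine Does.eff_seq (.const (by omega) (by omega)) ?_
  refine Does.eff_seq (.copy (by omega)) ?_
  refine Does.mono (does_forRange (k := 12) (t := 20)
    (Inv := fun u A' => A'.U = A.U ∧ A'.S = A.U.filter (· < u) ∧ ∃ V', Chain n A'.o V' A'.i ∧
      V' A'.i = A.U.filter (u ≤ ·) ∧ A'.i ≤ A.i ∧ ∀ j, A.i ≤ j → V' j = V j) (A := A)
    (i := 0) (e := n)
    (by omega) (by omega) (by omega) ?_ ?_ ?_ ⟨rfl, ?_, V, hV, ?_, le_rfl, fun _ _ => rfl⟩ ?_)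
    (by omega) (by omega) ?_
  · simp
  · simp [hA.r1]
  · exact hA.of_agree rfl rfl fun r hr => by simp [update_of_lt hr]
  · simp [hS]
  · simp [hU]
  · rintro c' A' u - hu hA' ⟨hU', hS', V', hV', hVi, hi, hVV⟩ hr -
    refine Does.eff_seq (.add (by omega) (by rw [hr, hA'.r2]; omega)) ?_
    refine Does.eff_seq (.load (by omega)) ?_
    refine Does.ite (fun h => ?_) (fun h => ?_)
    · have huU : u ∉ A.U := by
        rw [← hU']
        intro h'
        simp [hr, hA'.r2, hA'.mem, layout_U hu, h'] at h
      have e : ∀ x ∈ A.U, x ≠ u := fun x hx h => huU (h ▸ hx)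
      refine Does.le (Does.eff .skip (hA'.of_agree rfl rfl fun r hr => ?_)
        ⟨hU', ?_, V', hV', ?_, hi, hVV⟩) le_rfl (by omega)
      · simp [update_of_lt hr]
      · rw [hS']
        refine Finset.filter_congr fun x hx => ?_
        have := e x hx
        omega
      · rw [hVi]
        refine Finset.filter_congr fun x hx => ?_
        have := e x hx
        omega
    · have huU : u ∈ A'.U := by
        by_contra h'
        simp [hr, hA'.r2, hA'.mem, layout_U hu, h'] at h
      have huV : u ∈ V' A'.i := by
        rw [hVi, Finset.mem_filter, ← hU']
        exact ⟨huU, le_rfl⟩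
      have hpos := hV'.pos huV
      refine Does.seq_le (k := 14) (t := 15) (t₁ := 9) 5 (Does.le (k := 50)
        (does_flip (a := 12) (x := u) (A := A') hin ?_ ?_ hu (by omega)) (by omega) le_rfl)
        (by omega) ?_
      · exact hA'.of_agree rfl rfl fun r hr => by simp [update_of_lt hr]
      · simpa using hr
      rintro c1 _ hA1 rfl hf1
      refine Does.mono (does_place (a := 12) (x := u) hin hA1 ?_ (by omega) (by omega) hpos hV'.le)
        (by omega) le_rfl ?_
      · rw [hf1 12 (by omega) (by omega)]
        simpa using hr
      rintro _ rfl
      refine ⟨hU', ?_, _, hV'.place huV, ?_, (Nat.sub_le _ _).trans hi, fun j hj => ?_⟩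
      · show symmDiff A'.S {u} = _
        rw [hS', symmDiff_singleton_of_notMem (by simp)]
        ext x
        simp only [Finset.mem_insert, Finset.mem_filter]
        constructor
        · rintro (rfl | h)
          exacts [⟨hU' ▸ huU, by omega⟩, ⟨h.1, by omega⟩]
        · rintro ⟨h1, h2⟩
          by_cases h : x = u
          exacts [.inl h, .inr ⟨h1, by omega⟩]
      · dsimp only
        rw [Function.update_self, hVi]
        ext x
        simp only [Finset.mem_erase, Finset.mem_filter]
        constructor
        · rintro ⟨h, h1, h2⟩
          exact ⟨h1, by omega⟩
        · rintro ⟨h1, h2⟩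
          exact ⟨by omega, h1, by omega⟩
      · rw [Function.update_of_ne (show j ≠ A'.i - 1 by omega), hVV j hj]
  · rintro A' ⟨hU', hS', V', hV', hVi, hi, hVV⟩
    have hall : ∀ x ∈ A.U, x < n := fun x hx => Finset.mem_range.1 (hUn hx)
    have h0 : A'.i = 0 := by
      rw [← hV'.card le_rfl hV'.le, hVi, Finset.card_eq_zero, Finset.filter_eq_empty_iff]
      exact fun x hx => not_le.2 (hall x hx)
    refine ⟨hU', ?_, V', h0 ▸ hV', hVV⟩
    rw [hS', Finset.filter_true_of_mem hall]

theorem wp_prepare (hin : Input n b Δ M nb inp) (hreg : ∀ r, c.reg r = 0) (hmem : c.mem = inp)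
    (hcur : c.cur = ∅) (h0 : ∀ a, b ≤ a → inp a = 0) :
    wp M prepare (fun c' => ∃ A o V r, Rep n b inp c' A ∧ A.At (V r) (V r) o r 1 ∧
      c'.reg 10 = r ∧ c'.reg 11 = 1 ∧ r ≤ n ∧ Chain n o V 0 ∧
      ∑ j ∈ Finset.Ico r n, num nb (V (j + 1)) + 4 * Δ * num nb (V r) ≤
        4 * Δ * num nb (Finset.range n) ∧
      (∀ u, ∀ w ∈ nb u, ¬ (u ∈ V r ∧ w ∈ V r)) ∧ c'.log = c.log ∧
      c'.clock ≤ c.clock + (n * (Δ * (Δ * 40 + 42) + 43) + 40)) c := by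
  have hroom := hin.room
  refine wp.seq ((does_peel hin hreg hmem hcur h0 (c.clock + 1) c.log).mono ?_)
  rintro c1 ⟨⟨A1, hA1, ⟨V, hV, hU, hS, hpot⟩, hE⟩, -, hl1, ht1⟩
  refine wp.seq (Eff.wp (k := 10) (c := c1) (.copy (by omega)) (c1.clock + 1) c1.log ?_)
  have hA1' : Rep n b inp { c1 with reg := Function.update c1.reg 10 (c1.reg 6) } A1 :=
    hA1.of_agree rfl rfl fun r hr => by simp [update_of_lt hr]
  refine wp.seq ((does_fill hin hA1' hV hU hS (c1.clock + 1 + 1 + 1) c1.log).mono ?_)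
  rintro c2 ⟨⟨A2, hA2, hU2, hS2, V', hV', hVV⟩, hf2, hl2, ht2⟩
  have h10 : c2.reg 10 = A1.i := by
    rw [hf2 10 (by omega) (by omega)]
    simp [hA1.r6]
  refine wp.seq (Eff.wp (k := 10) (c := c2) (.copy (by omega)) (c2.clock + 1) c2.log ?_)
  refine wp.seq (Eff.wp (k := 10) (c := { c2 with reg := _ }) (.const (by omega) (by omega))
    (c2.clock + 1 + 1 + 1) c2.log ?_)
  refine Eff.wp (k := 10) (c := { c2 with reg := _ }) (.const (by omega) (by omega))
    (c2.clock + 1 + 1 + 1 + 1) c2.log ?_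
  refine ⟨{ A2 with i := A1.i, dir := 1 }, A2.o, V', A1.i, ?_, ⟨?_, ?_, rfl, rfl, rfl⟩, ?_, ?_, hV.le,
    hV', ?_, ?_, hl2.trans hl1, ?_⟩
  · constructor
    any_goals simp [hA2.mem, hA2.r2, hA2.cur, hA2.r0, hA2.r1, hA2.r3, hA2.r4, hA2.r5,
      hA2.r7, hA2.r8, h10]
    exact layout_congr rfl rfl rfl rfl
  · rw [hVV _ le_rfl, hU]; exact hU2
  · rw [hVV _ le_rfl, hU]; exact hS2
  · simp [h10]
  · simp
  · rw [hVV _ le_rfl, hU, Finset.sum_congr rfl fun j hj => by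
      rw [hVV (j + 1) (by rw [Finset.mem_Ico] at hj; omega)]]
    exact hpot
  · rw [hVV _ le_rfl, hU]; exact hE
  · have : n * (Δ * (Δ * 40 + 42) + 43) = n * (Δ * (Δ * 40 + 42) + 17) + n * 26 := by ring
    rw [this]
    show c2.clock + 1 + 1 + 1 + 1 + 1 ≤ _
    omega

end prepare

/-! ### Depth first search: cost and delay -/

/-- one move of the depth first search, `reg 9` telling the direction -/
def move : Prog :=
  -- Going down, level `n` means output and turning round; going up, the level in register `10`
  -- means that the search is complete.
  .ite 9 (.sub 14 1 6 ;; .ite 14 descend (.output ;; .const 9 0))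
    (.sub 14 6 10 ;; .ite 14 ascend (.const 11 0))

/-- A bound on the time of a move. -/
def moveTime (Δ : ℕ) : ℕ :=
  Δ * (Δ * (Δ * 14 + 31) + 19) + Δ * (Δ * 14 + 39) + Δ * 86 + 125

/-- Configuration `c` is at node `I` of level `j`, in direction `d`. -/
def AtNode (n b : ℕ) (inp : ℕ → ℕ) (V : ℕ → Finset ℕ) (o : ℕ → ℕ) (r : ℕ) (c : Config) (j : ℕ)
    (I : Finset ℕ) (d : ℕ) : Prop :=
  ∃ A, Rep n b inp c A ∧ A.At (V j) I o j d ∧ c.reg 10 = r ∧ c.reg 11 = 1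

theorem Reach.clock_le {M : ℕ} {c c' : Config} (h : Reach M c c') : c.clock ≤ c'.clock := by
  obtain ⟨t, -, ht, -⟩ := h
  omega

section moves
variable {n b Δ M : ℕ} {nb : ℕ → List ℕ} {inp : ℕ → ℕ} {c : Config} {V : ℕ → Finset ℕ}
  {o : ℕ → ℕ} {r j : ℕ} {I J : Finset ℕ}

theorem AtNode.of_wp (hf : c.Fits M) {d : ℕ} {Q : Config → Prop}
    (h : AtNode n b inp V o r c j I d) (hw : wp M move Q { c with clock := c.clock + 1 })
    (k : List Prog) :
    ∃ c', Reach M { c with todo := .loop 11 move :: k } { c' with todo := .loop 11 move :: k } ∧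
      c'.Fits M ∧ Q c' := by
  obtain ⟨A, -, -, -, h11⟩ := h
  exact loop_iterate hf (by rw [h11]; exact one_ne_zero) hw k

theorem move_down (hin : Input n b Δ M nb inp) (hV : Chain n o V 0) (hf : c.Fits M) (hj : j < n)
    (hI : MIS nb (V j) I) (h : AtNode n b inp V o r c j I 1) (k : List Prog) :
    ∃ c', Reach M { c with todo := .loop 11 move :: k } { c' with todo := .loop 11 move :: k } ∧
      c'.Fits M ∧ AtNode n b inp V o r c' (j + 1) (childA nb (o j) I) 1 ∧ c'.log = c.log ∧
      c'.clock ≤ c.clock + moveTime Δ := by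
  have hst := hV.step j (Nat.zero_le _) hj
  refine h.of_wp hf ?_ k
  obtain ⟨A, hA, hAt, h10, h11⟩ := h
  have h14 : Function.update c.reg 14 (c.reg 1 - c.reg 6) 14 = n - j := by
    simp [hA.r1, hA.r6, hAt.i]
  refine wp.ite (fun _ => ?_) (fun h9 => ?_)
  · refine wp.seq (Eff.wp (k := 12) (c := c) (.sub (by omega)) (c.clock + 1 + 1 + 1) c.log ?_)
    refine wp.ite (fun _ => ?_) (fun h14' => ?_)
    · have hA' : Rep n b inp
          { c with reg := Function.update c.reg 14 (c.reg 1 - c.reg 6) } A :=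
        hA.of_agree rfl rfl fun r hr => by simp [update_of_lt hr]
      refine (does_descend hin hA' hAt hj rfl (hV.lt (Nat.zero_le _) hj) (fun h => hst.1 (hI.1 h))
        (c.clock + 1 + 1 + 1 + 1 + 1) c.log).mono ?_
      rintro c' ⟨⟨A', hA', hAt'⟩, hf', hl, ht⟩
      refine ⟨⟨A', hA', by rw [hst.2]; exact hAt', ?_, ?_⟩, hl, ?_⟩
      · rw [hf' 10 (by omega) (by omega)]; simpa using h10
      · rw [hf' 11 (by omega) (by omega)]; simpa using h11
      · unfold moveTime; omega
    · exact absurd (h14.symm.trans h14') (by omega)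
  · have : c.reg 9 = 0 := h9
    rw [hA.r9, hAt.dir] at this
    omega

theorem move_leaf (hf : c.Fits M) (h : AtNode n b inp V o r c n I 1) (k : List Prog) :
    ∃ c', Reach M { c with todo := .loop 11 move :: k } { c' with todo := .loop 11 move :: k } ∧
      c'.Fits M ∧ AtNode n b inp V o r c' n I 0 ∧
      c'.clock ≤ c.clock + moveTime Δ ∧ ∃ t, c'.log = c.log ++ [(t, I)] ∧ c.clock ≤ t ∧
      t ≤ c.clock + moveTime Δ := by
  refine h.of_wp hf ?_ k
  obtain ⟨A, hA, hAt, h10, h11⟩ := h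
  have h14 : Function.update c.reg 14 (c.reg 1 - c.reg 6) 14 = n - n := by
    simp [hA.r1, hA.r6, hAt.i]
  refine wp.ite (fun _ => ?_) (fun h9 => ?_)
  · refine wp.seq (Eff.wp (k := 12) (c := c) (.sub (by omega)) (c.clock + 1 + 1 + 1) c.log ?_)
    refine wp.ite (fun h14' => ?_) (fun _ => ?_)
    · exact absurd (h14.trans (Nat.sub_self n)) h14'
    · refine wp.seq ?_
      refine wp.output (Eff.wp (k := 12) (c := { c with reg := Function.update c.reg 14 (c.reg 1 - c.reg 6) })
        (.const (r := 9) (v := 0) (Nat.zero_le _) (.inl (by norm_num)))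
        (c.clock + 1 + 1 + 1 + 1 + 1 + 1 + 1)
        (c.log ++ [(c.clock + 1 + 1 + 1 + 1 + 1 + 1 + 1, c.cur)]) ?_)
      refine ⟨⟨{ A with dir := 0 }, ?_, ⟨hAt.U, hAt.S, hAt.o, hAt.i, rfl⟩, ?_, ?_⟩, ?_, _,
        by rw [hA.cur, hAt.S], ?_, ?_⟩
      · constructor
        any_goals simp [hA.mem, hA.r2, hA.cur, hA.r0, hA.r1, hA.r3, hA.r4, hA.r5, hA.r6,
          hA.r7, hA.r8]
        exact layout_congr rfl rfl rfl rfl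
      · simpa using h10
      · simpa using h11
      · show c.clock + 1 + 1 + 1 + 1 + 1 + 1 + 1 + 1 ≤ _
        unfold moveTime; omega
      · omega
      · unfold moveTime; omega
  · have : c.reg 9 = 0 := h9
    rw [hA.r9, hAt.dir] at this
    omega

theorem move_up (hin : Input n b Δ M nb inp) (hV : Chain n o V 0) (hf : c.Fits M) (hr : r ≤ j)
    (hj : j < n) (hJ : MIS nb (V (j + 1)) J) (h : AtNode n b inp V o r c (j + 1) J 0)
    (k : List Prog) :
    ∃ c', Reach M { c with todo := .loop 11 move :: k } { c' with todo := .loop 11 move :: k } ∧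
      c'.Fits M ∧
      ((o j ∉ J ∧ HasB nb (V j) (o j) J) ∧
        AtNode n b inp V o r c' (j + 1) (childB nb (o j) J) 1 ∨
       ¬ (o j ∉ J ∧ HasB nb (V j) (o j) J) ∧
        AtNode n b inp V o r c' j (parent nb (V j) (o j) J) 0) ∧
      c'.log = c.log ∧ c'.clock ≤ c.clock + moveTime Δ := by
  have hst := hV.step j (Nat.zero_le _) hj
  refine h.of_wp hf ?_ k
  obtain ⟨A, hA, hAt, h10, h11⟩ := h
  have h14 : Function.update c.reg 14 (c.reg 6 - c.reg 10) 14 = j + 1 - r := by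
    simp [hA.r6, hAt.i, h10]
  rw [hst.2] at hAt hJ
  refine wp.ite (fun h9 => ?_) (fun _ => ?_)
  · have : c.reg 9 ≠ 0 := h9
    rw [hA.r9, hAt.dir] at this
    omega
  · refine wp.seq (Eff.wp (k := 12) (c := c) (.sub (by omega)) (c.clock + 1 + 1 + 1) c.log ?_)
    refine wp.ite (fun _ => ?_) (fun h14' => ?_)
    · have hA' : Rep n b inp
          { c with reg := Function.update c.reg 14 (c.reg 6 - c.reg 10) } A :=
        hA.of_agree rfl rfl fun r hr => by simp [update_of_lt hr]
      refine (does_ascend hin hA' hAt hj rfl (hV.lt (Nat.zero_le _) hj) hst.1 hJ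
        (c.clock + 1 + 1 + 1 + 1 + 1) c.log).mono ?_
      rintro c' ⟨⟨A', hA', hAt'⟩, hf', hl, ht⟩
      have h10' : c'.reg 10 = r := by
        rw [hf' 10 (by omega) (by omega)]; simpa using h10
      have h11' : c'.reg 11 = 1 := by
        rw [hf' 11 (by omega) (by omega)]; simpa using h11
      refine ⟨?_, hl, ?_⟩
      · rcases hAt' with ⟨h1, h2, h3⟩ | ⟨h1, h2⟩
        · exact .inl ⟨⟨h1, h2⟩, A', hA', by rw [hst.2]; exact h3, h10', h11'⟩
        · exact .inr ⟨h1, A', hA', h2, h10', h11'⟩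
      · unfold moveTime; omega
    · exact absurd (h14.symm.trans h14') (by omega)

end moves

section visit
variable {n b Δ M : ℕ} {nb : ℕ → List ℕ} {inp : ℕ → ℕ} {V : ℕ → Finset ℕ}
  {o : ℕ → ℕ} {r : ℕ}

/-- The times of the outputs `new` made between times `s` and `t`: there is one, the first comes at
most `e` after `s`, the last at most `e` before `t`, and gaps are at most `D`. -/
structure Timely (e D s t : ℕ) (new : List (ℕ × Finset ℕ)) : Prop where
  ne : new ≠ []
  first : ∀ x ∈ new.head?, s ≤ x.1 ∧ x.1 ≤ s + e
  last : ∀ x ∈ new.getLast?, t ≤ x.1 + e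
  chain : new.IsChain fun x y => y.1 ≤ x.1 + D

theorem Timely.widen {e e' D s s' t t' τ : ℕ} {new : List (ℕ × Finset ℕ)} (h : Timely e D s t new)
    (hs : s' ≤ s) (hs' : s ≤ s' + τ) (ht : t' ≤ t + τ) (he : e + τ ≤ e') :
    Timely e' D s' t' new where
  ne := h.ne
  first x hx := by have := h.first x hx; omega
  last x hx := by have := h.last x hx; omega
  chain := h.chain

theorem Timely.append {e D s₁ t₁ s₂ t₂ τ : ℕ} {new₁ new₂ : List (ℕ × Finset ℕ)}
    (h₁ : Timely e D s₁ t₁ new₁) (h₂ : Timely e D s₂ t₂ new₂) (h : s₂ ≤ t₁ + τ)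
    (hD : 2 * e + τ ≤ D) : Timely e D s₁ t₂ (new₁ ++ new₂) where
  ne := by simp [h₁.ne]
  first x hx := h₁.first x (by rwa [List.head?_append_of_ne_nil _ h₁.ne] at hx)
  last x hx := h₂.last x (by rwa [List.getLast?_append_of_ne_nil _ h₂.ne] at hx)
  chain := by
    refine List.isChain_append.2 ⟨h₁.chain, h₂.chain, fun x hx y hy => ?_⟩
    have := h₁.last x hx
    have := h₂.first y hy
    omega

/-- Two moves are charged per node. The spare `moveTime Δ` on the left pays for the move up that
follows the visit. All leaves are `m` levels below, so first output and end are each reached along a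
single path, which gives the bound `moveTime Δ * (m + 1)`. -/
theorem visit (hin : Input n b Δ M nb inp) (hV : Chain n o V 0) (k : List Prog) (m : ℕ) :
    ∀ (j : ℕ) (I : Finset ℕ) (c : Config), j + m = n → r ≤ j → MIS nb (V j) I → c.Fits M →
    AtNode n b inp V o r c j I 1 →
    ∃ c' new, Reach M { c with todo := .loop 11 move :: k } { c' with todo := .loop 11 move :: k } ∧
      c'.Fits M ∧ AtNode n b inp V o r c' j I 0 ∧ c'.log = c.log ++ new ∧
      new.map Prod.snd = leaves nb V o m j I ∧
      c'.clock + moveTime Δ ≤ c.clock + 2 * moveTime Δ * nodes nb V o m j I ∧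
      Timely (moveTime Δ * (m + 1)) (2 * moveTime Δ * (n + 1)) c.clock c'.clock new := by
  induction m with
  | zero =>
    intro j I c hj hr hI hf hc
    obtain rfl : j = n := hj
    obtain ⟨c', hR, hf', hc', ht, t, hl, ht1, ht2⟩ := move_leaf (Δ := Δ) hf hc k
    refine ⟨c', [(t, I)], hR, hf', hc', hl, by simp [leaves], by simp [nodes]; omega, ?_⟩
    constructor
    · simp
    · intro x hx
      obtain rfl : (t, I) = x := by simpa using hx
      simp only [zero_add, mul_one]
      exact ⟨ht1, ht2⟩
    · intro x hx
      obtain rfl : (t, I) = x := by simpa using hx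
      simp only [zero_add, mul_one]
      omega
    · simp
  | succ m ih =>
    intro j I c hj hr hI hf hc
    have hst := hV.step j (Nat.zero_le _) (by omega)
    have hvI : o j ∉ I := fun h => hst.1 (hI.1 h)
    have hAm : MIS nb (V (j + 1)) (childA nb (o j) I) := by
      rw [hst.2]; exact childA_mis hin.symm hin.irrefl hst.1 hI
    have hcA : HasB nb (V j) (o j) I → childA nb (o j) I = I := by
      rintro ⟨⟨w, hw, hwI⟩, -⟩
      exact if_neg fun h => h w hw hwI
    obtain ⟨c1, hR1, hf1, hc1, hl1, ht1⟩ := move_down hin hV hf (by omega) hI hc k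
    obtain ⟨c2, new2, hR2, hf2, hc2, hl2, hm2, ht2, hT2⟩ :=
      ih (j + 1) _ c1 (by omega) (by omega) hAm hf1 hc1
    obtain ⟨c3, hR3, hf3, hc3, hl3, ht3⟩ := move_up hin hV hf2 hr (by omega) hAm hc2 k
    have hlt1 := hR1.clock_le
    have hlt3 := hR3.clock_le
    dsimp only at hlt1 hlt3
    have hmm : moveTime Δ * (m + 1 + 1) = moveTime Δ * (m + 1) + moveTime Δ := by ring
    rcases hc3 with ⟨⟨hvA, hB⟩, hc3⟩ | ⟨hnB, hc3⟩
    · have hAI : childA nb (o j) I = I := by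
        by_contra hne
        unfold childA at hne hvA
        split_ifs at hne hvA with h
        · exact hvA (Finset.mem_insert_self _ _)
        · exact hne rfl
      rw [hAI] at hB hc3
      have hBm : MIS nb (V (j + 1)) (childB nb (o j) I) := by rw [hst.2]; exact hB.2.1
      obtain ⟨c4, new4, hR4, hf4, hc4, hl4, hm4, ht4, hT4⟩ :=
        ih (j + 1) _ c3 (by omega) (by omega) hBm hf3 hc3
      obtain ⟨c5, hR5, hf5, hc5, hl5, ht5⟩ := move_up hin hV hf4 hr (by omega) hBm hc4 k
      have hvB : o j ∈ childB nb (o j) I := Finset.mem_insert_self _ _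
      rcases hc5 with ⟨h, -⟩ | ⟨-, hc5⟩
      · exact absurd hvB h.1
      rw [parent_childB hvI hB.2.2] at hc5
      have hkids : kids nb (V j) (o j) I = [childA nb (o j) I, childB nb (o j) I] := by
        rw [kids, if_pos hB]
      refine ⟨c5, new2 ++ new4, (((hR1.trans hR2).trans hR3).trans hR4).trans hR5, hf5, hc5, ?_,
        ?_, ?_, ?_⟩
      · rw [hl5, hl4, hl3, hl2, hl1, List.append_assoc]
      · rw [List.map_append, hm2, hm4, leaves, hkids]
        simp
      · rw [nodes, hkids]
        simp only [List.map_cons, List.map_nil, List.sum_cons, List.sum_nil, add_zero]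
        rw [hAI] at ht2 ⊢
        rw [mul_add, mul_add, mul_one]
        omega
      -- Between the two subtrees there are a way up, one move and a way down; as `m + 1 ≤ n`, these
      -- fit into the gap bound.
      · have := Nat.mul_le_mul_left (moveTime Δ) (show m + 1 ≤ n by omega)
        refine (hT2.append (τ := moveTime Δ) hT4 (by omega) ?_).widen (τ := moveTime Δ) hlt1
          ht1 ht5 hmm.ge
        have e : 2 * moveTime Δ * (n + 1) = 2 * (moveTime Δ * n) + 2 * moveTime Δ := by ring
        omega
    · have hnB' : ¬ HasB nb (V j) (o j) I := by
        intro h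
        rw [hcA h] at hnB
        exact hnB ⟨hvI, h⟩
      have hkids : kids nb (V j) (o j) I = [childA nb (o j) I] := by
        rw [kids, if_neg hnB']
      rw [parent_childA hst.1 hI] at hc3
      refine ⟨c3, new2, (hR1.trans hR2).trans hR3, hf3, hc3, ?_, ?_, ?_, ?_⟩
      · rw [hl3, hl2, hl1]
      · rw [hm2, leaves, hkids]
        simp
      · rw [nodes, hkids]
        simp only [List.map_cons, List.map_nil, List.sum_cons, List.sum_nil, add_zero]
        rw [mul_add, mul_one]
        omega
      · exact hT2.widen (τ := moveTime Δ) hlt1 ht1 ht3 hmm.ge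

end visit

/-! ### The whole program and its total cost -/

/-- The program that lists the maximal independent sets. -/
def program : Prog := prepare ;; .loop 11 move

/-- A bound for the time of the initialization per vertex. -/
def prepareTime (Δ : ℕ) : ℕ := Δ * (Δ * 40 + 42) + 43

section enumerate
variable {n b Δ M : ℕ} {nb : ℕ → List ℕ} {inp : ℕ → ℕ} {c : Config} {V : ℕ → Finset ℕ}
  {o : ℕ → ℕ} {r : ℕ} {I : Finset ℕ}

theorem move_stop (hf : c.Fits M) (h : AtNode n b inp V o r c r I 0) (k : List Prog) :
    ∃ c' : Config, Reach M { c with todo := .loop 11 move :: k } { c' with todo := .loop 11 move :: k } ∧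
      c'.Fits M ∧ c'.reg 11 = 0 ∧ c'.log = c.log ∧ c'.clock ≤ c.clock + moveTime Δ := by
  refine h.of_wp hf ?_ k
  obtain ⟨A, hA, hAt, h10, h11⟩ := h
  have h14 : Function.update c.reg 14 (c.reg 6 - c.reg 10) 14 = 0 := by
    simp [hA.r6, hAt.i, h10]
  refine wp.ite (fun h9 => ?_) (fun _ => ?_)
  · have : c.reg 9 ≠ 0 := h9
    rw [hA.r9, hAt.dir] at this
    omega
  · refine wp.seq (Eff.wp (k := 12) (c := c) (.sub (by omega)) (c.clock + 1 + 1 + 1) c.log ?_)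
    refine wp.ite (fun h14' => absurd h14 h14') (fun _ => ?_)
    refine Eff.wp (k := 11) (c := { c with reg := Function.update c.reg 14 (c.reg 6 - c.reg 10) })
      (.const (r := 11) (v := 0) (Nat.zero_le _) (.inr le_rfl)) (c.clock + 1 + 1 + 1 + 1 + 1)
      c.log ⟨?_, rfl, ?_⟩
    · simp
    · show c.clock + 1 + 1 + 1 + 1 + 1 + 1 ≤ _
      unfold moveTime; omega

/-- This makes the root unique. -/
theorem mis_of_no_edge {U S : Finset ℕ} (h : ∀ u, ∀ w ∈ nb u, ¬ (u ∈ U ∧ w ∈ U)) :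
    MIS nb U S ↔ S = U := by
  constructor
  · intro hS
    refine hS.1.antisymm fun u hu => (hS.2 u hu).2 fun w hw hwS => h u w hw ⟨hu, hS.1 hwS⟩
  · rintro rfl
    exact ⟨subset_rfl, fun u hu => iff_of_true hu fun w hw hwS => h u w hw ⟨hu, hwS⟩⟩

/-- The invariant of peeling bounds all levels above `r` by `4 * Δ` times the final count; the root
level costs at most one more, by monotonicity. -/
theorem sum_num_le (hin : Input n b Δ M nb inp) (hV : Chain n o V 0) (hr : r ≤ n)
    (hpot : ∑ j ∈ Finset.Ico r n, num nb (V (j + 1)) + 4 * Δ * num nb (V r) ≤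
      4 * Δ * num nb (Finset.range n)) :
    ∑ j ∈ Finset.Ico r (n + 1), num nb (V j) ≤ (4 * Δ + 1) * num nb (Finset.range n) := by
  rw [Finset.sum_eq_sum_Ico_succ_bot (by omega), ← Finset.sum_Ico_add' (fun j => num nb (V j))]
  have := num_mono hin.symm hin.irrefl (hV.subset_range (Nat.zero_le r) hr)
  rw [add_mul, one_mul]
  omega

/-- Every level above `r` has at least one set, so at most `4 * Δ * num` vertices were peeled off;
the edgeless rest is at most `Δ` times as large. -/
theorem le_mul_num (hin : Input n b Δ M nb inp) (hV : Chain n o V 0) (hr : r ≤ n)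
    (hpot : ∑ j ∈ Finset.Ico r n, num nb (V (j + 1)) + 4 * Δ * num nb (V r) ≤
      4 * Δ * num nb (Finset.range n))
    (hE : ∀ u, ∀ w ∈ nb u, ¬ (u ∈ V r ∧ w ∈ V r)) (hne : ∀ v < n, nb v ≠ []) :
    n ≤ (Δ + 1) * (4 * Δ * num nb (Finset.range n)) := by
  have h1 : n - r ≤ ∑ j ∈ Finset.Ico r n, num nb (V (j + 1)) := by
    have := Finset.card_nsmul_le_sum (Finset.Ico r n) (fun j => num nb (V (j + 1))) 1
      fun j _ => num_pos hin.symm hin.irrefl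
    simpa using this
  have hVr := hV.card (Nat.zero_le r) hr
  have hVn := hV.subset_range (Nat.zero_le r) hr
  have h2 : r ≤ (n - r) * Δ := by
    -- A vertex of `V r` has some neighbour, which cannot lie in `V r` as well.
    have hsub : V r ⊆ (Finset.range n \ V r).biUnion fun w => (nb w).toFinset := by
      intro u hu
      obtain ⟨w, hw⟩ := List.exists_mem_of_ne_nil _ (hne u (Finset.mem_range.1 (hVn hu)))
      rw [Finset.mem_biUnion]
      exact ⟨w, Finset.mem_sdiff.2 ⟨Finset.mem_range.2 (hin.lt hw), fun h => hE u w hw ⟨hu, h⟩⟩,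
        List.mem_toFinset.2 (hin.symm _ _ hw)⟩
    have h3 := Finset.card_le_card hsub
    have h4 := Finset.card_biUnion_le_card_mul (Finset.range n \ V r) (fun w => (nb w).toFinset) Δ
      fun w _ => (List.toFinset_card_le _).trans (hin.deg w)
    rw [Finset.card_sdiff_of_subset hVn, Finset.card_range, hVr] at h4
    omega
  have h5 : n - r ≤ 4 * Δ * num nb (Finset.range n) := by omega
  have h6 := Nat.mul_le_mul_right Δ h5
  have e : (Δ + 1) * (4 * Δ * num nb (Finset.range n)) =
    4 * Δ * num nb (Finset.range n) * Δ + 4 * Δ * num nb (Finset.range n) := by ring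
  omega

theorem program_spec (hin : Input n b Δ M nb inp) (htodo : c.todo = [program])
    (hreg : ∀ r, c.reg r = 0) (hmem : c.mem = inp) (hcur : c.cur = ∅) (hclock : c.clock = 0)
    (hlog : c.log = []) (h0 : ∀ a, b ≤ a → inp a = 0) (hf : c.Fits M) :
    ∃ c' s t, Reach M c c' ∧ c'.todo = [] ∧ (c'.log.map Prod.snd).Nodup ∧
      (∀ S, S ∈ c'.log.map Prod.snd ↔ MIS nb (Finset.range n) S) ∧
      Timely (moveTime Δ * (n + 1)) (2 * moveTime Δ * (n + 1)) s t c'.log ∧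
      s ≤ prepareTime Δ * n + 41 ∧ c'.clock ≤ t + moveTime Δ + 1 ∧
      c'.clock ≤ s + 2 * moveTime Δ * ((4 * Δ + 1) * c'.log.length) + 1 ∧
      ((∀ v < n, nb v ≠ []) → n ≤ (Δ + 1) * (4 * Δ * c'.log.length)) := by
  have hR0 := Reach.one (M := M) (c := { c with todo := [program] }) hf hf rfl
  obtain ⟨c1, hR1, hf1, A, o, V, r, hA, hAt, h10, h11, hr, hV, hpot, hE, hl1, ht1⟩ :=
    wp_prepare (c := { c with clock := c.clock + 1 }) hin hreg hmem hcur h0 hf [.loop 11 move]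
  have hroot : MIS nb (V r) (V r) := (mis_of_no_edge hE).2 rfl
  obtain ⟨c2, new, hR2, hf2, hc2, hl2, hm2, ht2, hT⟩ :=
    visit hin hV [] (n - r) r (V r) c1 (by omega) le_rfl hroot hf1 ⟨A, hA, hAt, h10, h11⟩
  obtain ⟨c3, hR3, hf3, h113, hl3, ht3⟩ := move_stop (Δ := Δ) hf2 hc2 []
  have hR4 := loop_exit (p := move) hf3 h113 []
  obtain ⟨hnd, hmem', hsum⟩ := leaves_nodes hin.symm hin.irrefl (n - r) r [V r]
    (fun i _ hi => hV.step i (Nat.zero_le _) (by omega)) (List.nodup_singleton _)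
    (fun S => by rw [List.mem_singleton, mis_of_no_edge hE])
  rw [List.flatMap_singleton] at hnd hmem'
  rw [List.map_singleton, List.sum_singleton, show r + (n - r) + 1 = n + 1 by omega] at hsum
  rw [show r + (n - r) = n by omega, hV.top] at hmem'
  have hnum := num_eq_length hnd hmem'
  have hlog' : c3.log = new := by rw [hl3, hl2, hl1]; simp [hlog]
  rw [← hm2, List.length_map, ← hlog'] at hnum
  have hN := sum_num_le hin hV hr hpot
  have hiso := le_mul_num hin hV hr hpot hE
  rw [hnum] at hN hiso
  -- The witnesses for `s` and `t` are the end of the preparation and the end of the search of the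
  -- tree.
  refine ⟨{ c3 with todo := [], clock := c3.clock + 1 }, c1.clock, c2.clock, ?_, rfl, ?_, ?_, ?_,
    ?_, ?_, ?_, hiso⟩
  · have := (((hR0.trans hR1).trans hR2).trans hR3).trans hR4
    rwa [← htodo] at this
  · show (c3.log.map Prod.snd).Nodup
    rw [hlog', hm2]; exact hnd
  · show ∀ S, S ∈ c3.log.map Prod.snd ↔ _
    rw [hlog', hm2]; exact hmem'
  · show Timely _ _ _ _ c3.log
    rw [hlog']
    exact hT.widen (τ := 0) le_rfl le_rfl le_rfl
      (Nat.mul_le_mul_left (moveTime Δ) (show n - r + 1 ≤ n + 1 by omega))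
  · simp only [hclock] at ht1
    unfold prepareTime
    rw [mul_comm]
    omega
  · show c3.clock + 1 ≤ _
    omega
  · show c3.clock + 1 ≤ c1.clock + 2 * moveTime Δ * ((4 * Δ + 1) * c3.log.length) + 1
    rw [hsum] at ht2
    have := Nat.mul_le_mul_left (2 * moveTime Δ) hN
    omega

end enumerate

/-! ### Adjacency lists as machine input -/

section encode
variable {n : ℕ} {G : SimpleGraph (Fin n)} {adj : Fin n → List (Fin n)}

/-- The adjacency lists as lists of numbers. -/
def nbrs (adj : Fin n → List (Fin n)) (v : ℕ) : List ℕ :=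
  if h : v < n then (adj ⟨v, h⟩).map Fin.val else []

theorem mem_nbrs (hadj : IsAdjList G adj) {v w : ℕ} :
    w ∈ nbrs adj v ↔ ∃ (hv : v < n) (hw : w < n), G.Adj ⟨v, hv⟩ ⟨w, hw⟩ := by
  unfold nbrs
  split_ifs with h
  · rw [List.mem_map]
    constructor
    · rintro ⟨x, hx, rfl⟩
      exact ⟨h, x.2, ((hadj _).2 x).1 hx⟩
    · rintro ⟨hv, hw, hvw⟩
      exact ⟨⟨w, hw⟩, ((hadj _).2 _).2 hvw, rfl⟩
  · simp [h]

theorem length_adj [DecidableRel G.Adj] (hadj : IsAdjList G adj) (v : Fin n) :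
    (adj v).length = G.degree v := by
  rw [← List.toFinset_card_of_nodup (hadj v).1, ← G.card_neighborFinset_eq_degree]
  congr 1
  ext w
  rw [List.mem_toFinset, (hadj v).2, SimpleGraph.mem_neighborFinset]

/-- The length of the first `i` adjacency lists together. -/
def lengthUpTo (adj : Fin n → List (Fin n)) (i : ℕ) : ℕ :=
  (((List.finRange n).take i).flatMap adj).length

theorem take_succ_finRange {v : ℕ} (hv : v < n) :
    (List.finRange n).take (v + 1) = (List.finRange n).take v ++ [⟨v, hv⟩] := by
  rw [List.take_succ_eq_append_getElem (by simpa using hv)]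
  simp

theorem lengthUpTo_succ {v : ℕ} (hv : v < n) :
    lengthUpTo adj (v + 1) = lengthUpTo adj v + (adj ⟨v, hv⟩).length := by
  unfold lengthUpTo
  rw [take_succ_finRange hv]
  simp

theorem lengthUpTo_mono {i j : ℕ} (h : i ≤ j) (hj : j ≤ n) :
    lengthUpTo adj i ≤ lengthUpTo adj j := by
  induction j, h using Nat.le_induction with
  | base => exact le_rfl
  | succ m hm ih =>
    rw [lengthUpTo_succ (show m < n by omega)]
    have := ih (by omega)
    omega

theorem lengthUpTo_le {Δ : ℕ} (hΔ : ∀ v, (adj v).length ≤ Δ) {i : ℕ} (hi : i ≤ n) :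
    lengthUpTo adj i ≤ Δ * i := by
  induction i with
  | zero => simp [lengthUpTo]
  | succ i ih =>
    rw [lengthUpTo_succ (show i < n by omega), mul_add, mul_one]
    have := ih (by omega)
    have := hΔ ⟨i, by omega⟩
    omega

theorem length_flatMap_finRange :
    ((List.finRange n).flatMap adj).length = lengthUpTo adj n := by
  unfold lengthUpTo
  rw [List.take_of_length_le (by simp)]

theorem encode_length : (encode adj).length = n + 2 + lengthUpTo adj n := by
  simp only [encode, List.length_append, List.length_cons, List.length_map, List.length_range,
    length_flatMap_finRange]

theorem encode_zero : (encode adj).getD 0 0 = n := by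
  simp [encode]

theorem encode_succ {i : ℕ} (hi : i ≤ n) :
    (encode adj).getD (i + 1) 0 = n + 2 + lengthUpTo adj i := by
  have hi' : i < n + 1 := by omega
  rw [encode, List.getD_append _ _ _ _ (by simpa using hi)]
  rw [List.getD_cons_succ, List.getD_eq_getElem _ _ (by simpa using hi')]
  simp [lengthUpTo]

theorem encode_list {v j : ℕ} (hv : v < n) (hj : j < (adj ⟨v, hv⟩).length) :
    (encode adj).getD (n + 2 + lengthUpTo adj v + j) 0 = (adj ⟨v, hv⟩)[j] := by
  have hsplit : (List.finRange n).flatMap adj =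
      ((List.finRange n).take v).flatMap adj ++
        (adj ⟨v, hv⟩ ++ ((List.finRange n).drop (v + 1)).flatMap adj) := by
    conv_lhs => rw [← List.take_append_drop (v + 1) (List.finRange n), take_succ_finRange hv]
    simp
  rw [encode, List.getD_append_right _ _ _ _ (by simp; omega), hsplit, List.map_append,
    List.getD_append_right _ _ _ _ (by simp [lengthUpTo]; omega), List.map_append,
    List.getD_append _ _ _ _ (by simp [lengthUpTo]; omega), List.getD_eq_getElem _ _ (by
      simp [lengthUpTo]; omega)]
  simp [lengthUpTo]
  congr 2
  omega

theorem encode_le {x : ℕ} (hx : x ∈ encode adj) : x ≤ n + 2 + lengthUpTo adj n := by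
  simp only [encode, List.mem_append, List.mem_cons, List.mem_map, List.mem_range] at hx
  rcases hx with (rfl | ⟨i, hi, rfl⟩) | ⟨y, -, rfl⟩
  · omega
  · have := lengthUpTo_mono (adj := adj) (show i ≤ n by omega) le_rfl
    unfold lengthUpTo at this ⊢
    omega
  · have := y.2
    omega

theorem input_encode (hadj : IsAdjList G adj) {Δ M : ℕ} (hΔ : ∀ v, (adj v).length ≤ Δ)
    (hM : n + 2 + lengthUpTo adj n + n + n + n + n + 2 ≤ M) :
    Input n (n + 2 + lengthUpTo adj n) Δ M (nbrs adj) fun a => (encode adj).getD a 0 where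
  size := encode_zero
  finish := encode_succ le_rfl
  start_le := by omega
  room := hM
  seg v hv := by
    rw [encode_succ hv.le, encode_succ hv, lengthUpTo_succ hv, nbrs, dif_pos hv, List.length_map]
    omega
  seg_le v hv := by
    rw [encode_succ (i := v + 1) (by omega)]
    have := lengthUpTo_mono (adj := adj) (show v + 1 ≤ n by omega) le_rfl
    omega
  get v hv j h := by
    rw [encode_succ hv.le]
    simp only [nbrs, dif_pos hv, List.length_map] at h
    rw [encode_list hv h]
    simp [nbrs, hv]
  lt h := ((mem_nbrs hadj).1 h).2.1
  symm v w h := by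
    obtain ⟨hv, hw, h⟩ := (mem_nbrs hadj).1 h
    exact (mem_nbrs hadj).2 ⟨hw, hv, h.symm⟩
  irrefl v h := by
    obtain ⟨_, _, h⟩ := (mem_nbrs hadj).1 h
    exact G.irrefl h
  nodup v := by
    unfold nbrs
    split_ifs with h
    · exact (hadj _).1.map Fin.val_injective
    · exact List.nodup_nil
  deg v := by
    unfold nbrs
    split_ifs with h
    · rw [List.length_map]; exact hΔ _
    · exact Nat.zero_le _

/-- Independence and maximality merge into one local condition, the form used in `MIS`: a vertex
outside with no neighbour inside could be added. -/
theorem isMaxIndep_iff {I : Finset (Fin n)} :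
    IsMaxIndep G I ↔ ∀ u, u ∈ I ↔ ∀ w, G.Adj u w → w ∉ I := by
  have hind : ∀ J : Finset (Fin n), G.IsIndepSet (J : Set (Fin n)) ↔
      ∀ u ∈ J, ∀ w, G.Adj u w → w ∉ J := by
    intro J
    constructor
    · exact fun h u hu w huw hw => h hu hw huw.ne huw
    · exact fun h u hu w hw _ huw => h u hu w huw hw
  constructor
  · intro h u
    refine ⟨fun hu => (hind I).1 h.1 u hu, fun hu => ?_⟩
    have : G.IsIndepSet ((insert u I : Finset (Fin n)) : Set (Fin n)) := by
      rw [hind]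
      intro x hx w hxw hw
      rcases Finset.mem_insert.1 hx with rfl | hx' <;> rcases Finset.mem_insert.1 hw with rfl | hw'
      · exact G.irrefl hxw
      · exact hu w hxw hw'
      · exact hu x hxw.symm hx'
      · exact (hind I).1 h.1 x hx' w hxw hw'
    exact h.2 this (Finset.subset_insert _ _) (Finset.mem_insert_self _ _)
  · intro h
    refine ⟨(hind I).2 fun u hu => (h u).1 hu, fun J hJ hIJ u hu => ?_⟩
    exact (h u).2 fun w huw hw => (hind J).1 hJ u hu w huw (hIJ hw)

theorem mis_iff_isMaxIndep (hadj : IsAdjList G adj) (S : Finset ℕ) :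
    MIS (nbrs adj) (Finset.range n) S ↔
      ∃ I : Finset (Fin n), IsMaxIndep G I ∧ S = I.map Fin.valEmbedding := by
  have key : ∀ I : Finset (Fin n), MIS (nbrs adj) (Finset.range n) (I.map Fin.valEmbedding) ↔
      IsMaxIndep G I := by
    intro I
    have hmem : ∀ (x : ℕ) (hx : x < n), x ∈ I.map Fin.valEmbedding ↔ (⟨x, hx⟩ : Fin n) ∈ I := by
      intro x hx
      rw [Finset.mem_map]
      constructor
      · rintro ⟨y, hy, rfl⟩
        exact hy
      · exact fun h => ⟨_, h, rfl⟩
    rw [isMaxIndep_iff]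
    constructor
    · intro h u
      have := h.2 u.1 (Finset.mem_range.2 u.2)
      rw [hmem _ u.2] at this
      rw [this]
      constructor
      · exact fun h w huw hw =>
          h w.1 ((mem_nbrs hadj).2 ⟨u.2, w.2, huw⟩) ((hmem _ w.2).2 hw)
      · intro h w hw hwI
        obtain ⟨hu, hw', huw⟩ := (mem_nbrs hadj).1 hw
        exact h ⟨w, hw'⟩ huw ((hmem _ hw').1 hwI)
    · intro h
      refine ⟨fun x hx => ?_, fun x hx => ?_⟩
      · obtain ⟨y, -, rfl⟩ := Finset.mem_map.1 hx
        exact Finset.mem_range.2 y.2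
      · have hxn := Finset.mem_range.1 hx
        rw [hmem x hxn, h]
        constructor
        · intro h w hw hwI
          obtain ⟨hu, hw', huw⟩ := (mem_nbrs hadj).1 hw
          exact h ⟨w, hw'⟩ huw ((hmem _ hw').1 hwI)
        · exact fun h w huw hw =>
            h w.1 ((mem_nbrs hadj).2 ⟨hxn, w.2, huw⟩) ((hmem _ w.2).2 hw)
  constructor
  · intro h
    have hS : S = (Finset.univ.filter fun v : Fin n => v.1 ∈ S).map Fin.valEmbedding := by
      ext x
      simp only [Finset.mem_map, Finset.mem_filter, Finset.mem_univ, true_and,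
        Fin.valEmbedding_apply]
      constructor
      · exact fun hx => ⟨⟨x, Finset.mem_range.1 (h.1 hx)⟩, hx, rfl⟩
      · rintro ⟨y, hy, rfl⟩
        exact hy
    exact ⟨_, (key _).1 (hS ▸ h), hS⟩
  · rintro ⟨I, hI, rfl⟩
    exact (key I).2 hI

end encode

/-! ### Assembling the main theorem -/

theorem Timely.isChain_times {e D s t T τ d : ℕ} {L : List (ℕ × Finset ℕ)}
    (h : Timely e D s t L) (hs : s + e ≤ d) (hD : D ≤ d) (hT : T ≤ t + τ) (hd : e + τ ≤ d) :
    List.IsChain (fun s t => t ≤ s + d) (0 :: L.map Prod.fst ++ [T]) := by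
  obtain ⟨x, L, rfl⟩ := List.exists_cons_of_ne_nil h.ne
  rw [List.isChain_append]
  refine ⟨?_, List.isChain_singleton _, fun x hx y hy => ?_⟩
  · rw [List.map_cons, List.isChain_cons_cons, ← List.map_cons, List.isChain_map]
    refine ⟨?_, h.chain.imp fun x y hxy => by omega⟩
    have := h.first x (by simp)
    omega
  · obtain rfl : T = y := by simpa using hy
    rw [List.map_cons, List.getLast?_cons_cons, ← List.map_cons, List.getLast?_map,
      Option.mem_def, Option.map_eq_some_iff] at hx
    obtain ⟨z, hz, rfl⟩ := hx
    have := h.last z hz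
    omega

theorem step_iterate_of_halted {c : Config} (h : c.todo = []) (t : ℕ) : step^[t] c = c :=
  Function.iterate_fixed (by simp [step, h]) t

/-- A halted machine does not change any more, so the space bound extends to all times. -/
theorem Reach.fits_of_halted {M : ℕ} {c c' : Config} (h : Reach M c c') (h' : c'.todo = [])
    (t : ℕ) : (step^[t] c).Fits M := by
  obtain ⟨T, hT, -, hf⟩ := h
  rcases le_total t T with htT | htT
  · exact hf t htT
  · obtain ⟨d, rfl⟩ := Nat.exists_eq_add_of_le htT
    rw [Nat.add_comm, Function.iterate_add_apply, hT, step_iterate_of_halted h', ← hT]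
    exact hf T le_rfl

theorem start_fits {n M : ℕ} (adj : Fin n → List (Fin n)) (P : Prog)
    (hM : n + 2 + lengthUpTo adj n ≤ M) : (start P (encode adj)).Fits M := by
  refine ⟨fun _ => Nat.zero_le _, fun a => ?_, fun a ha => ?_⟩
  · change (encode adj).getD a 0 ≤ M
    by_cases h : a < (encode adj).length
    · rw [List.getD_eq_getElem _ _ h]
      exact (encode_le (List.getElem_mem h)).trans hM
    · rw [List.getD_eq_default _ _ (by omega)]
      exact Nat.zero_le _
  · exact List.getD_eq_default _ _ (by rw [encode_length]; omega)

/-- The constant of the main theorem. -/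
def bound (Δ : ℕ) : ℕ :=
  -- The first summand charges the preparation to the sets if no vertex is isolated, the second pays
  -- for the search. The others cover the preparation per vertex, the delay, and the memory for
  -- input and arrays.
  prepareTime Δ * ((Δ + 1) * (4 * Δ)) + 2 * moveTime Δ * (4 * Δ + 1) + prepareTime Δ +
    2 * moveTime Δ + Δ + 100

end MISListing

open MISListing

theorem mainTheorem8 :
    ∃ P : Prog, ∀ Δ : ℕ, ∃ (C : ℕ) (p : Polynomial ℕ),
      ∀ (n : ℕ) (G : SimpleGraph (Fin n)) [DecidableRel G.Adj] (adj : Fin n → List (Fin n)),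
        G.maxDegree ≤ Δ → IsAdjList G adj →
        ∃ (T t₁ : ℕ) (S₁ : Finset ℕ) (rest : List (ℕ × Finset ℕ)) (L : List (ℕ × Finset ℕ)),
          -- the machine halts after `T` steps, having output the list `L`,
          -- the first set of it at time `t₁`
          (run P (encode adj) T).todo = [] ∧ (run P (encode adj) T).clock = T ∧
          (run P (encode adj) T).log = L ∧ L = (t₁, S₁) :: rest ∧
          -- every maximal independent set is output exactly once, and nothing else is
          (L.map Prod.snd).Nodup ∧
          (∀ S : Finset ℕ, S ∈ L.map Prod.snd ↔
            ∃ I : Finset (Fin n), IsMaxIndep G I ∧ S = I.map Fin.valEmbedding) ∧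
          -- constant time per set, after an initialization in linear time
          t₁ ≤ C * (n + 1) ∧ T ≤ t₁ + C * L.length ∧
          -- constant time per set, initialization included, if no vertex is isolated
          ((∀ v, 0 < G.degree v) → T ≤ C * L.length) ∧
          -- linear space
          (∀ t, (run P (encode adj) t).Fits (C * (n + 1))) ∧
          -- polynomial delay: before the first set, between consecutive sets, after the last one
          List.IsChain (fun s t => t ≤ s + p.eval n) (0 :: L.map Prod.fst ++ [T]) := by
  refine ⟨program, fun Δ => ⟨bound Δ, Polynomial.C (bound Δ) * (Polynomial.X + 1), ?_⟩⟩
  intro n G _ adj hG hadj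
  have hdeg : ∀ v, (adj v).length ≤ Δ := fun v => by
    rw [length_adj hadj]
    exact (G.degree_le_maxDegree v).trans hG
  have hlen := lengthUpTo_le hdeg (le_refl n)
  have hC : bound Δ * (n + 1) =
      prepareTime Δ * ((Δ + 1) * (4 * Δ)) * (n + 1) + 2 * moveTime Δ * (4 * Δ + 1) * (n + 1) +
        prepareTime Δ * n + prepareTime Δ + 2 * (moveTime Δ * (n + 1)) + Δ * n + Δ + 100 * n +
        100 := by
    unfold bound; ring
  have hτ : moveTime Δ * (n + 1) = moveTime Δ * n + moveTime Δ := by ring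
  have hin := input_encode hadj (M := bound Δ * (n + 1)) hdeg (by omega)
  have hfits := start_fits (M := bound Δ * (n + 1)) adj program (by omega)
  obtain ⟨c, s, t, hR, htodo, hnd, hmem, htimes, hs, ht, hsum, hiso⟩ :=
    program_spec hin (c := start program (encode adj)) rfl (fun _ => rfl) rfl rfl rfl rfl
      (fun a ha => List.getD_eq_default _ _ (by rw [encode_length]; exact ha)) hfits
  have hrun : run program (encode adj) c.clock = c := by
    obtain ⟨T, hT, hclock, -⟩ := hR
    rw [show c.clock = T by rw [hclock]; exact Nat.zero_add T]
    exact hT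
  obtain ⟨⟨t₁, S₁⟩, rest, hL⟩ := List.exists_cons_of_ne_nil htimes.ne
  have hfirst := htimes.first (t₁, S₁) (by rw [hL]; rfl)
  dsimp only at hfirst
  have hpos : 1 ≤ c.log.length := List.length_pos_of_ne_nil htimes.ne
  have hCL : bound Δ * c.log.length =
      prepareTime Δ * ((Δ + 1) * (4 * Δ * c.log.length)) +
        2 * moveTime Δ * ((4 * Δ + 1) * c.log.length) + prepareTime Δ * c.log.length +
        2 * moveTime Δ * c.log.length + Δ * c.log.length + 100 * c.log.length := by
    unfold bound; ring
  have heval : (Polynomial.C (bound Δ) * (Polynomial.X + 1)).eval n = bound Δ * (n + 1) := by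
    simp
  refine ⟨c.clock, t₁, S₁, rest, c.log, by rw [hrun, htodo], by rw [hrun], by rw [hrun], hL, hnd,
    fun S => (hmem S).trans (mis_iff_isMaxIndep hadj S), by omega, by omega, fun hpos' => ?_,
    fun t => hR.fits_of_halted htodo t, ?_⟩
  -- Without isolated vertices `n` is bounded by a multiple of the number of sets, which turns the
  -- linear preparation time into constant time per set.
  · have := Nat.mul_le_mul_left (prepareTime Δ) (hiso fun v hv h => by
      have h1 := hpos' ⟨v, hv⟩
      rw [← length_adj hadj] at h1
      simp only [nbrs, dif_pos hv, List.map_eq_nil_iff] at h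
      simp [h] at h1)
    omega
  · rw [heval]
    have hD : 2 * moveTime Δ * (n + 1) = 2 * (moveTime Δ * (n + 1)) := by ring
    exact htimes.isChain_times (τ := moveTime Δ + 1) (by omega) (by omega) (by omega) (by omega)
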